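/- Let $d\ge 1$. A $d$-dimensional VASS is a pair $\mathcal A=(Q,T)$ with $Q$ a nonempty finite set of states and $T\subseteq Q\times\{-1,0,1\}^d\times Q$ a set of transitions. A finite path $p_0,\mathbf u_1,p_1,\dots,\mathbf u_\ell,p_\ell$ ($\ell\ge 1$, all $(p_{i},\mathbf u_{i+1},p_{i+1})\in T$) has effect $\mathbf u_1+\dots+\mathbf u_\ell$; it is a short cycle if $p_0=p_\ell$ and $\ell\le|Q|$. Let $\mathit{Inc}$ be the set of effects of short cycles, and $\mathrm{cone}(\mathit{Inc})$ the set of its finite linear combinations with non-negative real coefficients ($\{\vec 0\}$ if $\mathit{Inc}=\emptyset$). An SCC is a maximal $R\subseteq Q$ such that for all distinct $p,q\in R$ there is a finite path from $p$ to $q$; $\mathcal A_R$ denotes the VASS with states $R$ and transitions $T\cap(R\times\{-1,0,1\}^d\times R)$; and $\mathcal A$ is strongly connected if $Q$ is an SCC. A zero-avoiding computation of length $\ell\ge 0$ from $q_0\mathbf z_0$ is a sequence $q_0\mathbf z_0,\dots,q_\ell\mathbf z_\ell$ with $q_i\in Q$, $\mathbf z_i\in\mathbb N^d$, all components of every $\mathbf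 z_i$ positive, and $(q_i,\mathbf z_{i+1}-\mathbf z_i,q_{i+1})\in T$ for all $i<\ell$. The termination complexity $\mathcal L_{\mathcal A}(n)\in\mathbb N\cup\{\infty\}$ is the supremum of the lengths of zero-avoiding computations from configurations $q\mathbf z$ with $\max_i\mathbf z(i)=n$ (and $0$ if there are none); $\mathcal A$ is terminating if $\mathcal L_{\mathcal A}(n)<\infty$ for all $n$. For $f,g:\mathbb N\to\mathbb N$, $g\in\Theta(f)$ means that there are constants $a,b>0$ with $b f(n)\le g(n)\le a f(n)$ for all sufficiently large $n$. A normal of $\mathcal A$ is a nonzero $\mathbf n\in\mathbb R^d$ with $\mathbf v\cdot\mathbf n\le 0$ for all $\mathbf v\in\mathit{Inc}$. Condition (C) says that $\mathcal A$ has a normal all of whose components are positive. A normal $\mathbf n$ is good if all its components are positive and, for every $\mathbf v\in\mathrm{cone}(\mathit{Inc})$, $-\mathbf v\in\mathrm{cone}(\mathit{Inc})$ if and only if $\mathbf v\cdot\mathbf n=0$. **Theorem.** Let $\mathcal A=(Q,T)$ be a strongly connected $d$-dimensional VASS with $T\neq\emptyset$ satisfying (C), and let $\mathbf n$ be a good normal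 of $\mathcal A$. Let $\mathcal A^{\mathbf n}=(Q,T_{\mathbf n})$, where $T_{\mathbf n}$ is the set of all $t\in T$ contained in some short cycle of $\mathcal A$ with effect $\mathbf v$ satisfying $\mathbf v\cdot\mathbf n=0$. Let $C_1,\dots,C_k$ be all the distinct SCCs $R$ of $\mathcal A^{\mathbf n}$ for which $\mathcal A^{\mathbf n}_R$ has at least one transition. 1. If $k=0$, then $\mathcal A$ is terminating and $\mathcal L_{\mathcal A}(n)\in\Theta(n)$. 2. If $k>0$ and $f_1,\dots,f_k:\mathbb N\to\mathbb N$ are such that every $\mathcal A^{\mathbf n}_{C_i}$ is terminating with termination complexity in $\Theta(f_i(n))$, then $\mathcal A$ is terminating and $\mathcal L_{\mathcal A}(n)\in\Theta\bigl(n\cdot\max\{f_1(n),\dots,f_k(n)\}\bigr)$. -/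

import Mathlib

open Filter Asymptotics Matrix

/-- A `d`-dimensional vector addition system with states, with state space `Q`: a set of
transitions `(p, u, q)` where every component of `u` is `-1`, `0` or `1`. -/
structure VASS (d : ℕ) (Q : Type*) where
  trans : Set (Q × (Fin d → ℤ) × Q)
  unit_bound : ∀ t ∈ trans, ∀ i, t.2.1 i = -1 ∨ t.2.1 i = 0 ∨ t.2.1 i = 1

namespace VASS

variable {d : ℕ} {Q : Type*}

/-- `A.IsWalk p π q`: the list `π` of consecutive transitions of `A` leads from `p` to `q`
(the empty list leads from `p` to `p`). -/
def IsWalk (A : VASS d Q) : Q → List (Q × (Fin d → ℤ) × Q) → Q → Prop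
  | p, [], q => p = q
  | p, t :: π, q => t ∈ A.trans ∧ t.1 = p ∧ A.IsWalk t.2.2 π q

/-- A finite path `p₀, u₁, p₁, …, uₙ, pₙ` (`n ≥ 1`), given by the list of its transitions
`(pᵢ, uᵢ₊₁, pᵢ₊₁)`. Its length is the length of the list. -/
def IsPath (A : VASS d Q) (p : Q) (π : List (Q × (Fin d → ℤ) × Q)) (q : Q) : Prop :=
  1 ≤ π.length ∧ A.IsWalk p π q

/-- The effect of a path: the sum of the vectors of its transitions. -/
def eff (π : List (Q × (Fin d → ℤ) × Q)) : Fin d → ℤ :=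
  (π.map fun t => t.2.1).sum

/-- The effect of a path as a vector of `ℝ^d`. -/
def effR (π : List (Q × (Fin d → ℤ) × Q)) : Fin d → ℝ :=
  fun i => (eff π i : ℝ)

/-- A short cycle: a finite path from a state to itself of length at most `|Q|`. -/
def IsShortCycle (A : VASS d Q) (γ : List (Q × (Fin d → ℤ) × Q)) : Prop :=
  (∃ p, A.IsPath p γ p) ∧ γ.length ≤ Nat.card Q

/-- The set of increments: the effects of all short cycles. -/
def Inc (A : VASS d Q) : Set (Fin d → ℝ) :=
  {v | ∃ γ, A.IsShortCycle γ ∧ v = effR γ}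

/-- The strongly connected components: maximal sets of states any two distinct
elements of which are connected by a finite path. -/
def IsSCC (A : VASS d Q) (R : Set Q) : Prop :=
  Maximal (fun S : Set Q => ∀ p ∈ S, ∀ q ∈ S, p ≠ q → ∃ π, A.IsPath p π q) R

/-- `A` is strongly connected if the set of all states is an SCC. -/
def StronglyConnected (A : VASS d Q) : Prop :=
  A.IsSCC Set.univ

/-- The restriction of `A` to a set `R` of states, with all transitions inside `R`. -/
def restrict (A : VASS d Q) (R : Set Q) : VASS d R where
  trans := {t | ((t.1 : Q), t.2.1, (t.2.2 : Q)) ∈ A.trans}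
  unit_bound := fun _ ht i => A.unit_bound _ ht i

/-- The SCCs of `A` that contain at least one transition. -/
def nontrivialSCCs (A : VASS d Q) : Set (Set Q) :=
  {R | A.IsSCC R ∧ (A.restrict R).trans.Nonempty}

/-! ### Termination complexity -/

/-- The size of a configuration `p v`, `v ∈ ℕ^d`: the largest component of `v`. -/
def size (c : Q × (Fin d → ℕ)) : ℕ :=
  Finset.univ.sup c.2

/-- One step between two configurations. -/
def Step (A : VASS d Q) (c c' : Q × (Fin d → ℕ)) : Prop :=
  ∃ u : Fin d → ℤ, (c.1, u, c'.1) ∈ A.trans ∧ ∀ i, (c'.2 i : ℤ) = (c.2 i : ℤ) + u i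

/-- `α` is a zero-avoiding computation of length `ℓ` initiated in `c`: all counters of all its
configurations are positive. -/
def IsZeroAvoiding (A : VASS d Q) (c : Q × (Fin d → ℕ)) (ℓ : ℕ)
    (α : Fin (ℓ + 1) → Q × (Fin d → ℕ)) : Prop :=
  α 0 = c ∧ (∀ j i, 0 < (α j).2 i) ∧ ∀ j : Fin ℓ, A.Step (α j.castSucc) (α j.succ)

/-- The least `b ∈ ℕ ∪ {∞}` such that every zero-avoiding computation initiated in `c` has
length at most `b`. -/
noncomputable def maxLength (A : VASS d Q) (c : Q × (Fin d → ℕ)) : ℕ∞ :=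
  sInf {b : ℕ∞ | ∀ ℓ : ℕ, (∃ α, A.IsZeroAvoiding c ℓ α) → (ℓ : ℕ∞) ≤ b}

/-- The termination complexity, as a function with values in `ℕ ∪ {∞}`. -/
noncomputable def complexity (A : VASS d Q) (m : ℕ) : ℕ∞ :=
  sSup {b : ℕ∞ | ∃ c : Q × (Fin d → ℕ), size c = m ∧ b = A.maxLength c}

def Terminating (A : VASS d Q) : Prop :=
  ∀ m, A.complexity m ≠ ⊤

/-- `A` is terminating, so that its termination complexity is a function `ℕ → ℕ`, and this
function belongs to `Θ(f)`. -/
def TerminatingTheta (A : VASS d Q) (f : ℕ → ℕ) : Prop :=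
  A.Terminating ∧
    (fun m : ℕ => ((A.complexity m).toNat : ℝ)) =Θ[atTop] (fun m : ℕ => (f m : ℝ))

/-! ### Normals -/

/-- The nonzero `n` such that `v · n ≤ 0` for every increment `v`. -/
def Normals (A : VASS d Q) : Set (Fin d → ℝ) :=
  {n | n ≠ 0 ∧ ∀ v ∈ A.Inc, v ⬝ᵥ n ≤ 0}

/-- Condition (C) (for a strongly connected VASS): there is a positive normal. -/
def ConditionC (A : VASS d Q) : Prop :=
  ∃ n ∈ A.Normals, ∀ i, 0 < n i

/-- A good normal: a positive normal `n` such that, for every `v` in the cone generated by the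
increments, `-v` is in this cone iff `v · n = 0`. -/
def IsGoodNormal (A : VASS d Q) (n : Fin d → ℝ) : Prop :=
  n ∈ A.Normals ∧ (∀ i, 0 < n i) ∧
    ∀ v ∈ PointedCone.hull ℝ A.Inc, (-v ∈ PointedCone.hull ℝ A.Inc ↔ v ⬝ᵥ n = 0)

/-- The VASS with the states of `A` and those transitions of `A` that are contained in a short
cycle `γ` of `A` with `eff γ · n = 0`. -/
def neutralPart (A : VASS d Q) (n : Fin d → ℝ) : VASS d Q where
  trans := {t | t ∈ A.trans ∧ ∃ γ, A.IsShortCycle γ ∧ t ∈ γ ∧ effR γ ⬝ᵥ n = 0}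
  unit_bound := fun t ht i => A.unit_bound t ht.1 i

end VASS

namespace VASS

/-! ### Walks, safety of counters, and decomposition into short cycles -/

section Walks

variable {d : ℕ} {Q : Type*}

theorem isWalk_append {A : VASS d Q} {π ρ : List (Q × (Fin d → ℤ) × Q)} {p q : Q} :
    A.IsWalk p (π ++ ρ) q ↔ ∃ r, A.IsWalk p π r ∧ A.IsWalk r ρ q := by
  induction π generalizing p with
  | nil => simp [IsWalk]
  | cons t π ih =>
    simp only [List.cons_append, IsWalk, ih]
    constructor
    · rintro ⟨h1, h2, r, h3, h4⟩
      exact ⟨r, ⟨h1, h2, h3⟩, h4⟩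
    · rintro ⟨r, ⟨h1, h2, h3⟩, h4⟩
      exact ⟨h1, h2, r, h3, h4⟩

theorem IsWalk.append {A : VASS d Q} {π ρ : List (Q × (Fin d → ℤ) × Q)} {p q r : Q}
    (h : A.IsWalk p π q) (h' : A.IsWalk q ρ r) : A.IsWalk p (π ++ ρ) r :=
  isWalk_append.2 ⟨q, h, h'⟩

theorem IsWalk.mem_trans {A : VASS d Q} {π : List (Q × (Fin d → ℤ) × Q)} {p q : Q}
    (h : A.IsWalk p π q) : ∀ t ∈ π, t ∈ A.trans := by
  induction π generalizing p with
  | nil => simp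
  | cons t π ih =>
    intro s hs
    rcases List.mem_cons.1 hs with rfl | hs
    · exact h.1
    · exact ih h.2.2 s hs

theorem IsWalk.of_mem_trans {A B : VASS d Q} {π : List (Q × (Fin d → ℤ) × Q)} {p q : Q}
    (h : A.IsWalk p π q) (hB : ∀ t ∈ π, t ∈ B.trans) : B.IsWalk p π q := by
  induction π generalizing p with
  | nil => exact h
  | cons t π ih =>
    exact ⟨hB t (by simp), h.2.1, ih h.2.2 fun s hs => hB s (by simp [hs])⟩

theorem IsWalk.mono {A B : VASS d Q} (hAB : A.trans ⊆ B.trans)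
    {π : List (Q × (Fin d → ℤ) × Q)} {p q : Q} (h : A.IsWalk p π q) : B.IsWalk p π q :=
  h.of_mem_trans fun t ht => hAB (h.mem_trans t ht)

theorem IsWalk.flatten_replicate {A : VASS d Q} {π : List (Q × (Fin d → ℤ) × Q)} {p : Q}
    (h : A.IsWalk p π p) (m : ℕ) : A.IsWalk p (List.replicate m π).flatten p := by
  induction m with
  | zero => simp [IsWalk]
  | succ m ih =>
    rw [List.replicate_succ, List.flatten_cons]
    exact h.append ih

@[simp] theorem eff_nil : eff ([] : List (Q × (Fin d → ℤ) × Q)) = 0 := by simp [eff]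

@[simp] theorem eff_cons (t : Q × (Fin d → ℤ) × Q) (π : List (Q × (Fin d → ℤ) × Q)) :
    eff (t :: π) = t.2.1 + eff π := by simp [eff]

@[simp] theorem eff_append (π ρ : List (Q × (Fin d → ℤ) × Q)) :
    eff (π ++ ρ) = eff π + eff ρ := by simp [eff]

theorem eff_perm {π ρ : List (Q × (Fin d → ℤ) × Q)} (h : π.Perm ρ) : eff π = eff ρ :=
  (h.map _).sum_eq

theorem eff_flatten_replicate (m : ℕ) (π : List (Q × (Fin d → ℤ) × Q)) :
    eff (List.replicate m π).flatten = m • eff π := by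
  induction m with
  | zero => simp
  | succ m ih =>
    rw [List.replicate_succ, List.flatten_cons, eff_append, ih, succ_nsmul, add_comm]

@[simp] theorem effR_nil : effR ([] : List (Q × (Fin d → ℤ) × Q)) = 0 := by
  ext; simp [effR]

@[simp] theorem effR_append (π ρ : List (Q × (Fin d → ℤ) × Q)) :
    effR (π ++ ρ) = effR π + effR ρ := by ext; simp [effR]

theorem effR_perm {π ρ : List (Q × (Fin d → ℤ) × Q)} (h : π.Perm ρ) : effR π = effR ρ := by
  ext; simp [effR, eff_perm h]

theorem IsWalk.abs_eff_le {A : VASS d Q} {π : List (Q × (Fin d → ℤ) × Q)} {p q : Q}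
    (h : A.IsWalk p π q) (i : Fin d) : |eff π i| ≤ π.length := by
  induction π generalizing p with
  | nil => simp
  | cons t π ih =>
    have h1 := ih h.2.2
    have h2 : |t.2.1 i| ≤ 1 := by
      rcases A.unit_bound t h.1 i with h | h | h <;> simp [h]
    rw [eff_cons, Pi.add_apply]
    refine (abs_add_le _ _).trans ?_
    push_cast [List.length_cons]
    omega

/-- `Safe r π`: starting from the counter values `r`, all counters stay positive along `π`. -/
def Safe : (Fin d → ℤ) → List (Q × (Fin d → ℤ) × Q) → Prop
  | r, [] => ∀ i, 0 < r i
  | r, t :: π => (∀ i, 0 < r i) ∧ Safe (r + t.2.1) π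

theorem Safe.pos {r : Fin d → ℤ} {π : List (Q × (Fin d → ℤ) × Q)} (h : Safe r π) (i : Fin d) :
    0 < r i := by
  cases π with
  | nil => exact h i
  | cons t π => exact h.1 i

theorem safe_append {r : Fin d → ℤ} {π ρ : List (Q × (Fin d → ℤ) × Q)} :
    Safe r (π ++ ρ) ↔ Safe r π ∧ Safe (r + eff π) ρ := by
  induction π generalizing r with
  | nil => simpa [Safe] using fun h : Safe r ρ => h.pos
  | cons t π ih => simp [Safe, ih, add_assoc, and_assoc]

theorem Safe.mono {r s : Fin d → ℤ} {π : List (Q × (Fin d → ℤ) × Q)} (h : Safe r π)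
    (hrs : ∀ i, r i ≤ s i) : Safe s π := by
  induction π generalizing r s with
  | nil => exact fun i => (h i).trans_le (hrs i)
  | cons t π ih =>
    exact ⟨fun i => (h.1 i).trans_le (hrs i), ih h.2 fun i => by simpa using hrs i⟩

theorem Safe.pos_end {r : Fin d → ℤ} {π : List (Q × (Fin d → ℤ) × Q)} (h : Safe r π)
    (i : Fin d) : 0 < r i + eff π i := by
  have : Safe r (π ++ []) := by simpa using h
  exact (safe_append.1 this).2.pos i

theorem IsWalk.safe_of_length_lt {A : VASS d Q} {π : List (Q × (Fin d → ℤ) × Q)} {p q : Q}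
    (h : A.IsWalk p π q) {r : Fin d → ℤ} (hr : ∀ i, (π.length : ℤ) < r i) : Safe r π := by
  induction π generalizing p r with
  | nil => simpa [Safe] using hr
  | cons t π ih =>
    refine ⟨fun i => lt_of_le_of_lt (by positivity) (hr i), ih h.2.2 fun i => ?_⟩
    have h1 := hr i
    push_cast [List.length_cons] at h1
    have h2 : -1 ≤ t.2.1 i := by
      rcases A.unit_bound t h.1 i with h | h | h <;> simp [h]
    simp only [Pi.add_apply]
    omega

theorem exists_isZeroAvoiding_iff (A : VASS d Q) (c : Q × (Fin d → ℕ)) (ℓ : ℕ) :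
    (∃ α, A.IsZeroAvoiding c ℓ α) ↔
      ∃ π q, π.length = ℓ ∧ A.IsWalk c.1 π q ∧ Safe (fun i => (c.2 i : ℤ)) π := by
  induction ℓ generalizing c with
  | zero =>
    constructor
    · rintro ⟨α, h0, hpos, -⟩
      refine ⟨[], c.1, rfl, rfl, fun i => ?_⟩
      have := hpos 0 i
      rw [h0] at this
      exact Int.natCast_pos.2 this
    · rintro ⟨π, q, hl, -, hs⟩
      exact ⟨fun _ => c, rfl, fun _ i => by exact_mod_cast hs.pos i, fun j => j.elim0⟩
  | succ ℓ ih =>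
    constructor
    · rintro ⟨α, h0, hpos, hstep⟩
      obtain ⟨π, q, hl, hw, hs⟩ := (ih (α 1)).1
        ⟨fun j => α j.succ, rfl, fun j => hpos _, fun j => by
          have := hstep j.succ
          rwa [← Fin.succ_castSucc] at this⟩
      obtain ⟨u, hu, hu'⟩ := hstep 0
      simp only [Fin.castSucc_zero, Fin.succ_zero_eq_one, h0] at hu hu'
      refine ⟨(c.1, u, (α 1).1) :: π, q, by simp [hl], ⟨hu, rfl, hw⟩, fun i => ?_, ?_⟩
      · have := hpos 0 i
        rw [h0] at this
        exact Int.natCast_pos.2 this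
      · convert hs using 1
        ext i
        exact (hu' i).symm
    · rintro ⟨π, q, hl, hw, hs⟩
      cases π with
      | nil => simp at hl
      | cons t π =>
        obtain ⟨ht, htc, hw⟩ := hw
        obtain ⟨hs0, hs⟩ := hs
        have hz : ∀ i, (((c.2 i : ℤ) + t.2.1 i).toNat : ℤ) = (c.2 i : ℤ) + t.2.1 i :=
          fun i => Int.toNat_of_nonneg (hs.pos i).le
        obtain ⟨α, h0, hpos, hstep⟩ := (ih (t.2.2, fun i => ((c.2 i : ℤ) + t.2.1 i).toNat)).2
          ⟨π, q, by simpa using hl, hw, by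
            convert hs using 1
            ext i
            exact hz i⟩
        refine ⟨Fin.cons c α, rfl, fun j => ?_, fun j => ?_⟩
        · refine Fin.cases ?_ (fun j => ?_) j
          · intro i
            exact Int.natCast_pos.1 (hs0 i)
          · simpa using hpos j
        · refine Fin.cases ?_ (fun j => ?_) j
          · refine ⟨t.2.1, ?_, fun i => ?_⟩
            · simp only [Fin.castSucc_zero, Fin.cons_zero, Fin.cons_succ, h0, ← htc]
              exact ht
            · simp only [Fin.castSucc_zero, Fin.cons_zero, Fin.cons_succ, h0]
              exact hz i
          · rw [← Fin.succ_castSucc, Fin.cons_succ, Fin.cons_succ]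
            exact hstep j

/-- Raising counters keeps a computation zero-avoiding, so the constant vector `m` is the worst
start of size `m`. It has that size because `d` is positive. -/
theorem complexity_le_iff (hd : 0 < d) (A : VASS d Q) (m : ℕ) (b : ℕ∞) :
    A.complexity m ≤ b ↔ ∀ p π q, A.IsWalk p π q → Safe (fun _ => (m : ℤ)) π →
      (π.length : ℕ∞) ≤ b := by
  have hmax : ∀ c, A.maxLength c ≤ b ↔ ∀ π q, A.IsWalk c.1 π q →
      Safe (fun i => (c.2 i : ℤ)) π → (π.length : ℕ∞) ≤ b := by
    intro c
    constructor
    · intro h π q hw hs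
      refine le_trans (le_sInf fun b' hb' => ?_) h
      exact hb' _ ((exists_isZeroAvoiding_iff A c _).2 ⟨π, q, rfl, hw, hs⟩)
    · intro h
      refine sInf_le fun ℓ hℓ => ?_
      obtain ⟨π, q, rfl, hw, hs⟩ := (exists_isZeroAvoiding_iff A c ℓ).1 hℓ
      exact h π q hw hs
  constructor
  · intro h p π q hw hs
    have : Nonempty (Fin d) := ⟨⟨0, hd⟩⟩
    have h1 : A.maxLength (p, fun _ => m) ≤ A.complexity m :=
      le_sSup ⟨(p, fun _ => m), by simp [size, Finset.sup_const Finset.univ_nonempty], rfl⟩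
    exact (hmax (p, fun _ => m)).1 (h1.trans h) π q hw hs
  · intro h
    refine sSup_le ?_
    rintro _ ⟨c, rfl, rfl⟩
    refine (hmax c).2 fun π q hw hs => h c.1 π q hw (hs.mono fun i => ?_)
    exact_mod_cast Finset.le_sup (f := c.2) (Finset.mem_univ i)

theorem le_complexity (hd : 0 < d) (A : VASS d Q) (m : ℕ) {p q : Q}
    {π : List (Q × (Fin d → ℤ) × Q)} (hw : A.IsWalk p π q)
    (hs : Safe (fun _ => (m : ℤ)) π) : (π.length : ℕ∞) ≤ A.complexity m :=
  (complexity_le_iff hd A m _).1 le_rfl p π q hw hs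

/-- Lifting of transitions of a restricted VASS. -/
def incl (R : Set Q) (t : R × (Fin d → ℤ) × R) : Q × (Fin d → ℤ) × Q :=
  (t.1, t.2.1, t.2.2)

theorem incl_injective (R : Set Q) : Function.Injective (incl (d := d) R) := by
  rintro ⟨⟨a, _⟩, b, ⟨c, _⟩⟩ ⟨⟨a', _⟩, b', ⟨c', _⟩⟩ h
  simpa [incl] using h

theorem eff_map_incl (R : Set Q) (π : List (R × (Fin d → ℤ) × R)) :
    eff (π.map (incl R)) = eff π := by
  induction π with
  | nil => simp
  | cons t π ih => simp [ih, incl]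

theorem safe_map_incl (R : Set Q) (π : List (R × (Fin d → ℤ) × R)) (r : Fin d → ℤ) :
    Safe r (π.map (incl R)) ↔ Safe r π := by
  induction π generalizing r with
  | nil => simp [Safe]
  | cons t π ih => simp [Safe, ih, incl]

theorem IsWalk.map_incl {A : VASS d Q} {R : Set Q} {π : List (R × (Fin d → ℤ) × R)} {p q : R}
    (h : (A.restrict R).IsWalk p π q) : A.IsWalk p (π.map (incl R)) q := by
  induction π generalizing p with
  | nil => exact congrArg Subtype.val h
  | cons t π ih => exact ⟨h.1, congrArg Subtype.val h.2.1, ih h.2.2⟩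

theorem IsWalk.exists_restrict {A : VASS d Q} {R : Set Q}
    (hR : ∀ t ∈ A.trans, t.1 ∈ R → t.2.2 ∈ R) {π : List (Q × (Fin d → ℤ) × Q)} {p q : Q}
    (h : A.IsWalk p π q) (hp : p ∈ R) :
    ∃ (hq : q ∈ R) (π' : List (R × (Fin d → ℤ) × R)),
      (A.restrict R).IsWalk ⟨p, hp⟩ π' ⟨q, hq⟩ ∧ π'.map (incl R) = π := by
  induction π generalizing p with
  | nil =>
    obtain rfl : p = q := h
    exact ⟨hp, [], rfl, rfl⟩
  | cons t π ih =>
    obtain ⟨ht, rfl, hw⟩ := h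
    obtain ⟨hq, π', hw', rfl⟩ := ih hw (hR t ht hp)
    exact ⟨hq, (⟨t.1, hp⟩, t.2.1, ⟨t.2.2, hR t ht hp⟩) :: π', ⟨ht, rfl, hw'⟩, rfl⟩

variable [Finite Q]

theorem trans_finite (A : VASS d Q) : A.trans.Finite := by
  refine Set.Finite.subset (s := (Set.univ : Set Q) ×ˢ
    ((Set.univ.pi fun _ : Fin d => ({-1, 0, 1} : Set ℤ)) ×ˢ (Set.univ : Set Q))) ?_ ?_
  · exact Set.finite_univ.prod ((Set.Finite.pi fun _ => by simp).prod Set.finite_univ)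
  · intro t ht
    simpa using A.unit_bound t ht

theorem shortCycle_finite (A : VASS d Q) : {γ | A.IsShortCycle γ}.Finite := by
  have : Finite A.trans := A.trans_finite
  refine ((List.finite_length_le A.trans (Nat.card Q)).image (List.map Subtype.val)).subset ?_
  rintro γ ⟨⟨p, -, hw⟩, hl⟩
  obtain ⟨γ', rfl⟩ : ∃ γ' : List A.trans, γ'.map Subtype.val = γ := by
    refine ⟨γ.attach.map fun t => ⟨t.1, hw.mem_trans t.1 t.2⟩, ?_⟩
    rw [List.map_map]
    exact List.attach_map_subtype_val γ
  exact ⟨γ', by simpa using hl, rfl⟩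

/-- Every walk decomposes into short cycles and a short walk. -/
theorem IsWalk.exists_decomposition {A : VASS d Q} {π : List (Q × (Fin d → ℤ) × Q)} {p q : Q}
    (h : A.IsWalk p π q) : ∃ (Γ : List (List (Q × (Fin d → ℤ) × Q)))
      (ρ : List (Q × (Fin d → ℤ) × Q)), (∀ γ ∈ Γ, A.IsShortCycle γ) ∧ A.IsWalk p ρ q ∧
      ρ.length ≤ Nat.card Q ∧ π.Perm (Γ.flatten ++ ρ) := by
  induction hn : π.length using Nat.strong_induction_on generalizing π with
  | _ n ih =>
  by_cases hl : π.length ≤ Nat.card Q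
  · exact ⟨[], π, by simp, h, hl, by simp⟩
  push Not at hl
  have hst : ∀ i : ℕ, ∃ r, A.IsWalk p (π.take i) r ∧ A.IsWalk r (π.drop i) q := by
    intro i
    exact isWalk_append.1 (by rwa [List.take_append_drop])
  choose s hs1 hs2 using hst
  have : Fintype Q := Fintype.ofFinite Q
  -- Pigeonhole on the first `|Q| + 1` visited states: the factor between two equal ones is a short
  -- cycle, and the induction removes it.
  obtain ⟨i, j, hij, hsij⟩ := Fintype.exists_ne_map_eq_of_card_lt
    (fun i : Fin (Nat.card Q + 1) => s i) (by simp)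
  wlog hlt : i < j generalizing i j
  · exact this j i hij.symm hsij.symm (lt_of_le_of_ne (not_lt.1 hlt) hij.symm)
  replace hsij : s i = s j := hsij
  have hlt' : (i : ℕ) < j := hlt
  have hj := j.2
  have h3 : A.IsWalk (s i) (π.drop i) q := hs2 i
  have hsplit : π.drop i = (π.drop i).take (j - i) ++ π.drop j := by
    conv_lhs => rw [← List.take_append_drop (j - i) (π.drop i)]
    rw [List.drop_drop]
    congr 2
    omega
  have htake : π.take j = π.take i ++ (π.drop i).take (j - i) := by
    conv_lhs => rw [show (j : ℕ) = i + (j - i) by omega, List.take_add]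
  have hcyc : A.IsWalk (s i) ((π.drop i).take (j - i)) (s i) := by
    have h1 := hs1 j
    rw [htake, ← hsij] at h1
    obtain ⟨r, hr1, hr2⟩ := isWalk_append.1 h1
    have huniq : ∀ (σ : List (Q × (Fin d → ℤ) × Q)) (a b c : Q),
        A.IsWalk a σ b → A.IsWalk a σ c → b = c := by
      intro σ
      induction σ with
      | nil => intro a b c h1 h2; exact h1.symm.trans h2
      | cons t σ ih => intro a b c h1 h2; exact ih _ _ _ h1.2.2 h2.2.2
    rwa [huniq _ _ _ _ hr1 (hs1 i)] at hr2
  have hclen : ((π.drop i).take (j - i)).length = j - i := by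
    rw [List.length_take, List.length_drop]
    omega
  have hrest : A.IsWalk p (π.take i ++ π.drop j) q :=
    (hs1 i).append (by rw [hsij]; exact hs2 j)
  obtain ⟨Γ, ρ, hΓ, hρ, hρl, hperm⟩ := ih _ (by
    rw [← hn, List.length_append, List.length_take, List.length_drop]
    omega) hrest rfl
  refine ⟨(π.drop i).take (j - i) :: Γ, ρ, ?_, hρ, hρl, ?_⟩
  · intro γ hγ
    rcases List.mem_cons.1 hγ with rfl | hγ
    · exact ⟨⟨s i, by omega, hcyc⟩, by omega⟩
    · exact hΓ γ hγ
  · have h1 : π = π.take i ++ ((π.drop i).take (j - i) ++ π.drop j) := by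
      rw [← hsplit, List.take_append_drop]
    conv_lhs => rw [h1]
    rw [List.flatten_cons, List.append_assoc]
    refine List.Perm.trans ?_ (hperm.append_left _)
    exact List.perm_append_comm_assoc _ _ _

/-- The leftover walk is closed too, so it is either empty or itself a short cycle. -/
theorem IsWalk.exists_decomposition_of_closed {A : VASS d Q}
    {π : List (Q × (Fin d → ℤ) × Q)} {p : Q} (h : A.IsWalk p π p) :
    ∃ Γ : List (List (Q × (Fin d → ℤ) × Q)), (∀ γ ∈ Γ, A.IsShortCycle γ) ∧
      π.Perm Γ.flatten := by
  obtain ⟨Γ, ρ, hΓ, hρ, hl, hperm⟩ := h.exists_decomposition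
  by_cases h0 : ρ = []
  · subst h0
    exact ⟨Γ, hΓ, by simpa using hperm⟩
  · refine ⟨Γ ++ [ρ], fun γ hγ => ?_, by simpa using hperm⟩
    rcases List.mem_append.1 hγ with hγ | hγ
    · exact hΓ γ hγ
    · obtain rfl := List.mem_singleton.1 hγ
      exact ⟨⟨p, List.length_pos_iff.2 h0, hρ⟩, hl⟩

end Walks

end VASS

namespace VASS

/-! ### Reversibility of the neutral part and the potential given by a normal -/

section NeutralPart

variable {d : ℕ} {Q : Type*}

theorem isSCC_of_closed {B : VASS d Q} {p : Q} (hsymm : ∀ q π, B.IsWalk p π q → ∃ ρ, B.IsWalk q ρ p) :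
    B.IsSCC {q | ∃ π, B.IsWalk p π q} := by
  have hpath : ∀ {a b : Q} {π}, a ≠ b → B.IsWalk a π b → B.IsPath a π b := by
    intro a b π hab h
    refine ⟨?_, h⟩
    cases π with
    | nil => exact absurd h hab
    | cons t π => simp
  refine ⟨?_, ?_⟩
  · rintro a ⟨π, hπ⟩ b ⟨ρ, hρ⟩ hab
    obtain ⟨π', hπ'⟩ := hsymm a π hπ
    exact ⟨π' ++ ρ, hpath hab (hπ'.append hρ)⟩
  · intro S hS hsub b hb
    by_cases hpb : p = b
    · exact ⟨[], hpb⟩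
    · obtain ⟨π, hπ⟩ := hS p (hsub ⟨[], rfl⟩) b hb hpb
      exact ⟨π, hπ.2⟩

theorem IsSCC.eq_reachable {B : VASS d Q} (hsymm : ∀ p q π, B.IsWalk p π q → ∃ ρ, B.IsWalk q ρ p)
    {R : Set Q} (hR : B.IsSCC R) {p : Q} (hp : p ∈ R) : R = {q | ∃ π, B.IsWalk p π q} := by
  refine hR.eq_of_subset (isSCC_of_closed (hsymm p)).prop fun b hb => ?_
  by_cases hpb : p = b
  · exact ⟨[], hpb⟩
  · obtain ⟨π, hπ⟩ := hR.prop p hp b hb hpb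
    exact ⟨π, hπ.2⟩

theorem StronglyConnected.exists_walk {A : VASS d Q} (h : A.StronglyConnected) (p q : Q) :
    ∃ π, A.IsWalk p π q := by
  by_cases hpq : p = q
  · exact ⟨[], hpq⟩
  · have h' : A.IsSCC Set.univ := h
    obtain ⟨π, hπ⟩ := h'.prop p trivial q trivial hpq
    exact ⟨π, hπ.2⟩

theorem neutralPart_subset (A : VASS d Q) (n : Fin d → ℝ) :
    (A.neutralPart n).trans ⊆ A.trans := fun _ h => h.1

theorem exists_return {A : VASS d Q} {n : Fin d → ℝ} {t : Q × (Fin d → ℤ) × Q}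
    (ht : t ∈ (A.neutralPart n).trans) :
    ∃ ρ, (A.neutralPart n).IsWalk t.2.2 ρ t.1 ∧ effR [t] ⬝ᵥ n + effR ρ ⬝ᵥ n = 0 := by
  obtain ⟨-, γ, hγ, htγ, h0⟩ := ht
  obtain ⟨p, -, hw⟩ := hγ.1
  have hw' : (A.neutralPart n).IsWalk p γ p :=
    hw.of_mem_trans fun s hs => ⟨hw.mem_trans s hs, γ, hγ, hs, h0⟩
  obtain ⟨γ₁, γ₂, rfl⟩ := List.append_of_mem htγ
  obtain ⟨r, h1, h2, rfl, h3⟩ := isWalk_append.1 hw'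
  refine ⟨γ₂ ++ γ₁, h3.append h1, ?_⟩
  rw [← add_dotProduct, ← effR_append, ← h0]
  congr 1
  refine effR_perm ?_
  rw [List.singleton_append, ← List.cons_append]
  exact List.perm_append_comm

/-- Each transition is undone by the rest of its neutral cycle. Reachability in the neutral part is
therefore symmetric, and its SCCs are the reachability classes. -/
theorem IsWalk.exists_reverse {A : VASS d Q} {n : Fin d → ℝ} {π : List (Q × (Fin d → ℤ) × Q)}
    {p q : Q} (h : (A.neutralPart n).IsWalk p π q) :
    ∃ ρ, (A.neutralPart n).IsWalk q ρ p ∧ effR π ⬝ᵥ n + effR ρ ⬝ᵥ n = 0 := by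
  induction π generalizing p with
  | nil => exact ⟨[], h.symm, by simp⟩
  | cons t π ih =>
    obtain ⟨ht, rfl, hw⟩ := h
    obtain ⟨ρ, hρ, h0⟩ := ih hw
    obtain ⟨σ, hσ, h1⟩ := exists_return ht
    refine ⟨ρ ++ σ, hρ.append hσ, ?_⟩
    rw [← List.singleton_append, effR_append, effR_append, add_dotProduct, add_dotProduct]
    linarith

theorem isSCC_reachable (A : VASS d Q) (n : Fin d → ℝ) (p : Q) :
    (A.neutralPart n).IsSCC {q | ∃ π, (A.neutralPart n).IsWalk p π q} :=
  isSCC_of_closed fun _ _ h => let ⟨ρ, hρ, _⟩ := h.exists_reverse; ⟨ρ, hρ⟩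

theorem IsSCC.eq_reachable_neutralPart {A : VASS d Q} {n : Fin d → ℝ} {R : Set Q}
    (hR : (A.neutralPart n).IsSCC R) {p : Q} (hp : p ∈ R) :
    R = {q | ∃ π, (A.neutralPart n).IsWalk p π q} :=
  hR.eq_reachable (fun _ _ _ h => let ⟨ρ, hρ, _⟩ := h.exists_reverse; ⟨ρ, hρ⟩) hp

theorem IsSCC.closed {A : VASS d Q} {n : Fin d → ℝ} {R : Set Q}
    (hR : (A.neutralPart n).IsSCC R) :
    ∀ t ∈ (A.neutralPart n).trans, t.1 ∈ R → t.2.2 ∈ R := by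
  intro t ht h
  rw [hR.eq_reachable_neutralPart h]
  exact ⟨[t], ht, rfl, rfl⟩

theorem IsSCC.exists_walk_restrict {A : VASS d Q} {n : Fin d → ℝ} {R : Set Q}
    (hR : (A.neutralPart n).IsSCC R) (p q : R) :
    ∃ π, ((A.neutralPart n).restrict R).IsWalk p π q := by
  obtain ⟨π, hπ⟩ := (hR.eq_reachable_neutralPart p.2).subset q.2
  obtain ⟨_, π', hπ', -⟩ := hπ.exists_restrict hR.closed p.2
  exact ⟨π', hπ'⟩

theorem effR_flatten_dotProduct_nonpos {n : Fin d → ℝ} {Γ : List (List (Q × (Fin d → ℤ) × Q))}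
    (h : ∀ γ ∈ Γ, effR γ ⬝ᵥ n ≤ 0) : effR Γ.flatten ⬝ᵥ n ≤ 0 := by
  induction Γ with
  | nil => simp
  | cons γ Γ ih =>
    rw [List.flatten_cons, effR_append, add_dotProduct]
    have h1 := h γ (by simp)
    have h2 := ih fun γ' hγ' => h γ' (by simp [hγ'])
    linarith

theorem IsWalk.abs_dotProduct_le {A : VASS d Q} {n : Fin d → ℝ} (hn : ∀ i, 0 < n i)
    {π : List (Q × (Fin d → ℤ) × Q)} {p q : Q} (h : A.IsWalk p π q) :
    |effR π ⬝ᵥ n| ≤ π.length * ∑ i, n i := by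
  rw [dotProduct, Finset.mul_sum]
  refine (Finset.abs_sum_le_sum_abs _ _).trans (Finset.sum_le_sum fun i _ => ?_)
  rw [abs_mul, abs_of_pos (hn i)]
  refine mul_le_mul_of_nonneg_right ?_ (hn i).le
  have := h.abs_eff_le i
  rw [effR]
  exact_mod_cast this

variable [Finite Q]

theorem IsWalk.dotProduct_nonpos {A : VASS d Q} {n : Fin d → ℝ} (hn : ∀ v ∈ A.Inc, v ⬝ᵥ n ≤ 0)
    {π : List (Q × (Fin d → ℤ) × Q)} {p : Q} (h : A.IsWalk p π p) : effR π ⬝ᵥ n ≤ 0 := by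
  obtain ⟨Γ, hΓ, hperm⟩ := h.exists_decomposition_of_closed
  rw [effR_perm hperm]
  exact effR_flatten_dotProduct_nonpos fun γ hγ => hn _ ⟨γ, hΓ γ hγ, rfl⟩

/-- The walk and its return are both closed, so both products are nonpositive; they sum to zero. -/
theorem IsWalk.dotProduct_eq_zero {A : VASS d Q} {n : Fin d → ℝ}
    (hn : ∀ v ∈ A.Inc, v ⬝ᵥ n ≤ 0) {π : List (Q × (Fin d → ℤ) × Q)} {p : Q}
    (h : (A.neutralPart n).IsWalk p π p) : effR π ⬝ᵥ n = 0 := by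
  obtain ⟨ρ, hρ, h0⟩ := h.exists_reverse
  have h1 := (h.mono (A.neutralPart_subset n)).dotProduct_nonpos hn
  have h2 := (hρ.mono (A.neutralPart_subset n)).dotProduct_nonpos hn
  linarith

theorem IsWalk.dotProduct_le {A : VASS d Q} {n : Fin d → ℝ} (hpos : ∀ i, 0 < n i)
    (hn : ∀ v ∈ A.Inc, v ⬝ᵥ n ≤ 0) {π : List (Q × (Fin d → ℤ) × Q)} {p q : Q}
    (h : A.IsWalk p π q) : effR π ⬝ᵥ n ≤ Nat.card Q * ∑ i, n i := by
  obtain ⟨Γ, ρ, hΓ, hρ, hl, hperm⟩ := h.exists_decomposition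
  rw [effR_perm hperm, effR_append, add_dotProduct]
  have h1 := effR_flatten_dotProduct_nonpos (n := n) fun γ hγ => hn _ ⟨γ, hΓ γ hγ, rfl⟩
  have h2 := (abs_le.1 (hρ.abs_dotProduct_le hpos)).2
  have h3 : (ρ.length : ℝ) * ∑ i, n i ≤ Nat.card Q * ∑ i, n i :=
    mul_le_mul_of_nonneg_right (by exact_mod_cast hl) (Finset.sum_nonneg fun i _ => (hpos i).le)
  linarith

/-- Along a walk all counters stay linear in the size of the initial configuration. -/
theorem exists_counter_bound {A : VASS d Q} {n : Fin d → ℝ} (hpos : ∀ i, 0 < n i)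
    (hn : ∀ v ∈ A.Inc, v ⬝ᵥ n ≤ 0) : ∃ K : ℕ, ∀ (N : ℕ), 1 ≤ N → ∀ p π q, A.IsWalk p π q →
      Safe (fun _ => (N : ℤ)) π → ∀ i, (N : ℤ) + eff π i ≤ K * N := by
  set S := ∑ i, n i
  have hS : 0 ≤ S := Finset.sum_nonneg fun i _ => (hpos i).le
  -- The potential stays at most `N * S + |Q| * S ≤ (1 + |Q|) * S * N`. By positivity each summand
  -- is bounded by the whole, so one divides by `n i`.
  obtain ⟨K, hK⟩ := exists_nat_ge (∑ i, (1 + Nat.card Q) * S / n i)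
  refine ⟨K, fun N hN p π q hw hs i => ?_⟩
  have h1 : effR π ⬝ᵥ n ≤ Nat.card Q * S := hw.dotProduct_le hpos hn
  have h2 : ((N : ℝ) + effR π i) * n i ≤ ∑ j, ((N : ℝ) + effR π j) * n j :=
    Finset.single_le_sum (f := fun j => ((N : ℝ) + effR π j) * n j) (fun j _ => by
      have := hs.pos_end j
      have h3 : (0 : ℝ) < (N : ℝ) + effR π j := by
        rw [effR]
        exact_mod_cast this
      exact (mul_pos h3 (hpos j)).le) (Finset.mem_univ i)
  have h3 : ∑ j, ((N : ℝ) + effR π j) * n j = N * S + effR π ⬝ᵥ n := by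
    simp only [add_mul, Finset.sum_add_distrib, ← Finset.mul_sum, dotProduct, S]
  have hN' : (1 : ℝ) ≤ N := by exact_mod_cast hN
  have h4 : (Nat.card Q : ℝ) * S ≤ Nat.card Q * S * N :=
    le_mul_of_one_le_right (by positivity) hN'
  have h5 : (1 + Nat.card Q) * S / n i ≤ K := le_trans
    (Finset.single_le_sum (f := fun i => (1 + Nat.card Q) * S / n i)
      (fun j _ => div_nonneg (by positivity) (hpos j).le) (Finset.mem_univ i)) hK
  rw [div_le_iff₀ (hpos i)] at h5
  have h6 : ((N : ℝ) + effR π i) * n i ≤ (K * N) * n i := by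
    have := mul_le_mul_of_nonneg_right h5 (zero_le_one.trans hN')
    nlinarith
  have h7 := le_of_mul_le_mul_right h6 (hpos i)
  rw [effR] at h7
  exact_mod_cast h7

end NeutralPart

/-! ### Upper bound -/

section Upper

variable {d : ℕ} {Q : Type*}

/-- From size `N`, the computations of `A` have length `O(N ^ k)`. -/
def UpperPoly (A : VASS d Q) (k : ℕ) : Prop :=
  ∃ K : ℕ, ∀ (N : ℕ) (p : Q) π q, A.IsWalk p π q → Safe (fun _ => (N : ℤ)) π →
    π.length ≤ K * N ^ k

theorem one_le_of_safe (hd : 0 < d) {N : ℕ} {π : List (Q × (Fin d → ℤ) × Q)}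
    (h : Safe (fun _ => (N : ℤ)) π) : 1 ≤ N := by
  have := h.pos ⟨0, hd⟩
  omega

theorem UpperPoly.mono (hd : 0 < d) {A : VASS d Q} {k l : ℕ} (hkl : k ≤ l) (h : A.UpperPoly k) :
    A.UpperPoly l := by
  obtain ⟨K, hK⟩ := h
  refine ⟨K, fun N p π q hw hs => (hK N p π q hw hs).trans ?_⟩
  exact Nat.mul_le_mul_left _ (Nat.pow_le_pow_right (one_le_of_safe hd hs) hkl)

/-- The marked elements cut the list into `countP + 1` unmarked gaps, each of length at most `B`. -/
theorem length_le_of_infix_bound {α : Type*} (b : α → Bool) (B : ℕ) (l : List α)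
    (h : ∀ l₁ s l₂, l = l₁ ++ s ++ l₂ → (∀ t ∈ s, b t = false) → s.length ≤ B) :
    l.length ≤ (l.countP b + 1) * (B + 1) := by
  induction hn : l.length using Nat.strong_induction_on generalizing l with
  | _ m ih =>
  subst hn
  have hsplit := List.takeWhile_append_dropWhile (p := fun t => !b t) (l := l)
  have h1 : (l.takeWhile fun t => !b t).length ≤ B :=
    h [] _ (l.dropWhile fun t => !b t) (by simp) fun t ht => by
      simpa using List.mem_takeWhile_imp ht
  cases hdrop : l.dropWhile (fun t => !b t) with
  | nil =>
    rw [hdrop, List.append_nil] at hsplit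
    rw [hsplit] at h1
    nlinarith
  | cons t l' =>
    have hbt : b t = true := by
      have := List.head_dropWhile_not (p := fun t => !b t) (l := l) (by simp [hdrop])
      simpa [hdrop] using this
    rw [hdrop] at hsplit
    set u := l.takeWhile fun t => !b t
    have hlen : l.length = u.length + (l'.length + 1) := by
      rw [← hsplit]; simp
    have hcount : l'.countP b + 1 ≤ l.countP b := by
      rw [← hsplit, List.countP_append, List.countP_cons, hbt]
      simp
    have := ih l'.length (by omega) l' (fun l₁ s l₂ hl' hs =>
      h (u ++ t :: l₁) s l₂ (by rw [← hsplit, hl']; simp) hs) rfl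
    rw [hlen]
    nlinarith

variable [Finite Q]

open Classical in
/-- The number of transitions outside the neutral part is linear. -/
theorem exists_countP_bound {A : VASS d Q} {n : Fin d → ℝ} (hpos : ∀ i, 0 < n i)
    (hn : ∀ v ∈ A.Inc, v ⬝ᵥ n ≤ 0) : ∃ K : ℕ, ∀ (N : ℕ), 1 ≤ N → ∀ p π q, A.IsWalk p π q →
      Safe (fun _ => (N : ℤ)) π →
      π.countP (fun t => decide (t ∉ (A.neutralPart n).trans)) ≤ K * N := by
  set b := fun t => decide (t ∉ (A.neutralPart n).trans)
  set S := ∑ i, n i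
  have hS : 0 ≤ S := Finset.sum_nonneg fun i _ => (hpos i).le
  -- The potential lost by a cycle pays for its non-neutral transitions: a neutral cycle has none,
  -- and the finitely many others share one rate `M`.
  obtain ⟨M, hM⟩ : ∃ M : ℝ, 0 ≤ M ∧ ∀ γ, A.IsShortCycle γ →
      (γ.countP b : ℝ) ≤ M * -(effR γ ⬝ᵥ n) := by
    have hterm : ∀ γ, A.IsShortCycle γ → ∃ M : ℝ, 0 ≤ M ∧
        (γ.countP b : ℝ) ≤ M * -(effR γ ⬝ᵥ n) := by
      intro γ hγ
      rcases (hn _ ⟨γ, hγ, rfl⟩).eq_or_lt with h0 | h0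
      · refine ⟨0, le_rfl, ?_⟩
        have : γ.countP b = 0 := by
          rw [List.countP_eq_zero]
          intro t ht
          obtain ⟨p, -, hw⟩ := hγ.1
          have : t ∈ (A.neutralPart n).trans := ⟨hw.mem_trans t ht, γ, hγ, ht, h0⟩
          simp only [b, this, not_true_eq_false, decide_false, Bool.false_eq_true,
            not_false_eq_true]
        simp [this]
      · exact ⟨γ.countP b / -(effR γ ⬝ᵥ n), div_nonneg (by positivity) (by linarith),
          (div_mul_cancel₀ _ (by linarith)).ge⟩
    choose! M hM0 hM using hterm
    refine ⟨∑ γ ∈ A.shortCycle_finite.toFinset, M γ, Finset.sum_nonneg fun γ hγ =>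
      hM0 γ (by simpa using hγ), fun γ hγ => (hM γ hγ).trans ?_⟩
    refine mul_le_mul_of_nonneg_right ?_ (by linarith [hn _ ⟨γ, hγ, rfl⟩])
    exact Finset.single_le_sum (f := M) (fun γ hγ => hM0 γ (by simpa using hγ)) (by simpa using hγ)
  obtain ⟨hM0, hM⟩ := hM
  obtain ⟨K, hK⟩ := exists_nat_ge (M * (S + Nat.card Q * S) + Nat.card Q)
  refine ⟨K, fun N hN p π q hw hs => ?_⟩
  obtain ⟨Γ, ρ, hΓ, hρ, hl, hperm⟩ := hw.exists_decomposition
  have hΓc : (Γ.flatten.countP b : ℝ) ≤ M * -(effR Γ.flatten ⬝ᵥ n) := by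
    clear hperm
    induction Γ with
    | nil => simp
    | cons γ Γ ih =>
      have h1 := hM γ (hΓ γ (by simp))
      have h2 := ih fun γ' hγ' => hΓ γ' (by simp [hγ'])
      rw [List.flatten_cons, effR_append, add_dotProduct, List.countP_append]
      push_cast
      linarith
  have hρc : (ρ.countP b : ℝ) ≤ Nat.card Q := by
    exact_mod_cast List.countP_le_length.trans hl
  have hρn := (abs_le.1 (hρ.abs_dotProduct_le hpos)).2
  -- The initial potential is `N * S` and the final one is nonnegative.
  have hπn : -(N * S) ≤ effR π ⬝ᵥ n := by
    have h3 : ∑ j, ((N : ℝ) + effR π j) * n j = N * S + effR π ⬝ᵥ n := by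
      simp only [add_mul, Finset.sum_add_distrib, ← Finset.mul_sum, dotProduct, S]
    have h4 : 0 ≤ ∑ j, ((N : ℝ) + effR π j) * n j := Finset.sum_nonneg fun j _ => by
      have := hs.pos_end j
      have h3 : (0 : ℝ) < (N : ℝ) + effR π j := by
        rw [effR]
        exact_mod_cast this
      exact (mul_pos h3 (hpos j)).le
    linarith
  rw [effR_perm hperm, effR_append, add_dotProduct] at hπn
  rw [hperm.countP_eq, List.countP_append]
  have hN' : (1 : ℝ) ≤ N := by exact_mod_cast hN
  have h5 : (ρ.length : ℝ) * S ≤ Nat.card Q * S * N := by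
    have : (ρ.length : ℝ) * S ≤ Nat.card Q * S :=
      mul_le_mul_of_nonneg_right (by exact_mod_cast hl) hS
    exact this.trans (le_mul_of_one_le_right (by positivity) hN')
  have h6 : M * -(effR Γ.flatten ⬝ᵥ n) ≤ M * (N * S + Nat.card Q * S * N) :=
    mul_le_mul_of_nonneg_left (by linarith) hM0
  have h7 : (Nat.card Q : ℝ) ≤ Nat.card Q * N := le_mul_of_one_le_right (by positivity) hN'
  have h8 := mul_le_mul_of_nonneg_right hK (zero_le_one.trans hN')
  have : ((Γ.flatten.countP b : ℝ) + ρ.countP b) ≤ K * N := by nlinarith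
  exact_mod_cast this

/-- A computation has `O(N)` non-neutral transitions, and each gap between them is a computation of
one SCC started with counters `O(N)`. For `e = 0` and no nontrivial SCC the gaps are empty. -/
theorem upperPoly_succ (hd : 0 < d) {A : VASS d Q} {n : Fin d → ℝ} (hpos : ∀ i, 0 < n i)
    (hn : ∀ v ∈ A.Inc, v ⬝ᵥ n ≤ 0) {e : ℕ}
    (h : ∀ R ∈ (A.neutralPart n).nontrivialSCCs, ((A.neutralPart n).restrict R).UpperPoly e) :
    A.UpperPoly (e + 1) := by
  classical
  obtain ⟨K₁, hK₁⟩ := exists_counter_bound hpos hn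
  obtain ⟨K₂, hK₂⟩ := exists_countP_bound hpos hn
  have hfin : (A.neutralPart n).nontrivialSCCs.Finite := Set.toFinite _
  choose! K hK using h
  set K₃ := ∑ R ∈ hfin.toFinset, K R
  have hseg : ∀ (M : ℕ) p π q, (A.neutralPart n).IsWalk p π q → Safe (fun _ => (M : ℤ)) π →
      π.length ≤ K₃ * M ^ e := by
    intro M p π q hw hs
    cases π with
    | nil => simp
    | cons t π =>
      have hR := isSCC_reachable A n p
      set R := {q | ∃ π, (A.neutralPart n).IsWalk p π q}
      have hp : p ∈ R := ⟨[], rfl⟩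
      obtain ⟨hq, π', hw', hπ'⟩ := hw.exists_restrict hR.closed hp
      have hmem : R ∈ (A.neutralPart n).nontrivialSCCs := by
        refine ⟨hR, ?_⟩
        cases π' with
        | nil => simp at hπ'
        | cons t' π' => exact ⟨t', hw'.1⟩
      rw [← hπ', safe_map_incl] at hs
      have := hK R hmem M _ π' _ hw' hs
      rw [← hπ', List.length_map]
      refine this.trans (Nat.mul_le_mul_right _ ?_)
      exact Finset.single_le_sum (f := K) (fun _ _ => Nat.zero_le _) (by simpa using hmem)
  refine ⟨(K₂ + 1) * (K₃ * K₁ ^ e + 1), fun N p π q hw hs => ?_⟩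
  have hN := one_le_of_safe hd hs
  have h1 := length_le_of_infix_bound (fun t => decide (t ∉ (A.neutralPart n).trans))
    (K₃ * (K₁ * N) ^ e) π (fun l₁ s l₂ hl hgood => by
      subst hl
      obtain ⟨r, hw12, -⟩ := isWalk_append.1 hw
      obtain ⟨r', hw1, hw2⟩ := isWalk_append.1 hw12
      obtain ⟨hs1, hs2⟩ := safe_append.1 (safe_append.1 hs).1
      refine hseg (K₁ * N) r' s r (hw2.of_mem_trans fun t ht => by simpa using hgood t ht)
        (hs2.mono fun i => ?_)
      push_cast
      exact hK₁ N hN p l₁ r' hw1 hs1 i)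
  have h2 := hK₂ N hN p π q hw hs
  have hNe : 1 ≤ N ^ e := Nat.one_le_pow _ _ hN
  calc π.length ≤ _ := h1
    _ ≤ (K₂ * N + N) * (K₃ * (K₁ * N) ^ e + N ^ e) := Nat.mul_le_mul (by omega) (by omega)
    _ = _ := by rw [mul_pow]; ring

end Upper

end VASS

namespace VASS

/-! ### Lower bound -/

section Lower

variable {d : ℕ} {Q : Type*}

/-- From some size linear in `N`, there is a computation of `A` of length at least `N ^ k`. -/
def LowerPoly (A : VASS d Q) (k : ℕ) : Prop :=
  ∃ K : ℕ, ∀ N : ℕ, 1 ≤ N → ∃ p π q, A.IsWalk p π q ∧ Safe (fun _ => ((K * N : ℕ) : ℤ)) π ∧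
    N ^ k ≤ π.length

theorem lowerPoly_one {A : VASS d Q} (hT : A.trans.Nonempty)
    (hA : ∀ p q, ∃ π, A.IsWalk p π q) : A.LowerPoly 1 := by
  obtain ⟨t₀, ht₀⟩ := hT
  have hout : ∀ p, ∃ t ∈ A.trans, t.1 = p := by
    intro p
    obtain ⟨π, hπ⟩ := hA p t₀.1
    cases π with
    | nil => exact ⟨t₀, ht₀, hπ.symm⟩
    | cons t π => exact ⟨t, hπ.1, hπ.2.1⟩
  have hlong : ∀ ℓ p, ∃ π q, A.IsWalk p π q ∧ π.length = ℓ := by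
    intro ℓ
    induction ℓ with
    | zero => exact fun p => ⟨[], p, rfl, rfl⟩
    | succ ℓ ih =>
      intro p
      obtain ⟨t, ht, htp⟩ := hout p
      obtain ⟨π, q, hπ, hl⟩ := ih t.2.2
      exact ⟨t :: π, q, ⟨ht, htp, hπ⟩, by simp [hl]⟩
  refine ⟨2, fun N hN => ?_⟩
  obtain ⟨π, q, hπ, hl⟩ := hlong N t₀.1
  refine ⟨_, π, q, hπ, hπ.safe_of_length_lt fun i => ?_, by simp [hl]⟩
  rw [hl]
  push_cast
  omega

/-- A fixed closed walk `σ` visits a state of every cycle in `G`; there any number of copies of that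
cycle can be inserted. -/
theorem exists_tour {A : VASS d Q} (hA : ∀ p q, ∃ π, A.IsWalk p π q)
    (G : Finset (List (Q × (Fin d → ℤ) × Q))) (hG : ∀ γ ∈ G, ∃ p, A.IsWalk p γ p) (q : Q) :
    ∃ σ, A.IsWalk q σ q ∧ ∀ m : List (Q × (Fin d → ℤ) × Q) → ℕ, ∃ π, A.IsWalk q π q ∧
      eff π = eff σ + ∑ γ ∈ G, m γ • eff γ ∧
      π.length = σ.length + ∑ γ ∈ G, m γ * γ.length := by
  classical
  induction G using Finset.induction_on with
  | empty => exact ⟨[], rfl, fun m => ⟨[], rfl, by simp, by simp⟩⟩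
  | insert γ G hγG ih =>
    obtain ⟨σ, hσ, hm⟩ := ih fun γ' hγ' => hG γ' (Finset.mem_insert_of_mem hγ')
    obtain ⟨p, hp⟩ := hG γ (Finset.mem_insert_self _ _)
    obtain ⟨α, hα⟩ := hA q p
    obtain ⟨β, hβ⟩ := hA p q
    refine ⟨(α ++ β) ++ σ, (hα.append hβ).append hσ, fun m => ?_⟩
    obtain ⟨π, hπ, he, hl⟩ := hm m
    refine ⟨((α ++ (List.replicate (m γ) γ).flatten) ++ β) ++ π,
      ((hα.append (hp.flatten_replicate _)).append hβ).append hπ, ?_, ?_⟩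
    · rw [Finset.sum_insert hγG]
      simp only [eff_append, eff_flatten_replicate, he]
      abel
    · rw [Finset.sum_insert hγG]
      simp only [List.length_append, hl, List.length_flatten, List.map_replicate,
        List.sum_replicate, smul_eq_mul]
      ring

/-- A linear section of `c ↦ ∑ c γ • v γ` solves the equation with coefficients of size `O(M)`.
Adding a multiple of the null combination `a` makes them nonnegative. -/
theorem exists_compensation {ι : Type*} (G : Finset ι) (v : ι → Fin d → ℝ) (a : ι → ℝ)
    (ha : ∀ γ ∈ G, 1 ≤ a γ) (h0 : ∑ γ ∈ G, a γ • v γ = 0) :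
    ∃ C : ℝ, 0 ≤ C ∧ ∀ (M : ℝ) (b : ι → ℝ), 0 ≤ M → (∀ i, |(∑ γ ∈ G, b γ • v γ) i| ≤ M) →
      ∃ c : ι → ℝ, (∀ γ ∈ G, 0 ≤ c γ ∧ c γ ≤ C * M) ∧
        ∑ γ ∈ G, c γ • v γ = -∑ γ ∈ G, b γ • v γ := by
  classical
  let Φ : (G → ℝ) →ₗ[ℝ] (Fin d → ℝ) := Fintype.linearCombination ℝ fun γ : G => v γ
  obtain ⟨g, hg⟩ := Φ.rangeRestrict.exists_rightInverse_of_surjective Φ.range_rangeRestrict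
  obtain ⟨Ψ, hΨ⟩ := LinearMap.exists_extend g
  have hΦΨ : ∀ x, Φ (Ψ (Φ x)) = Φ x := by
    intro x
    have h1 := LinearMap.congr_fun hg ⟨Φ x, x, rfl⟩
    have h2 := LinearMap.congr_fun hΨ ⟨Φ x, x, rfl⟩
    simp only [LinearMap.comp_apply, Submodule.subtype_apply, LinearMap.id_apply] at h1 h2
    rw [h2]
    exact congrArg Subtype.val h1
  set C₁ := ‖Ψ.toContinuousLinearMap‖
  have hA : 0 ≤ ∑ γ ∈ G, a γ := Finset.sum_nonneg fun γ hγ => zero_le_one.trans (ha γ hγ)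
  refine ⟨C₁ * (1 + ∑ γ ∈ G, a γ), by positivity, fun M b hM hb => ?_⟩
  set w := ∑ γ ∈ G, b γ • v γ
  have hw : w = Φ fun γ => b γ := by
    simp only [Φ, Fintype.linearCombination_apply, w]
    exact (Finset.sum_coe_sort G fun γ => b γ • v γ).symm
  have hΨw : ∀ γ, |Ψ w γ| ≤ C₁ * M := by
    intro γ
    refine (norm_le_pi_norm (Ψ w) γ).trans ((Ψ.toContinuousLinearMap.le_opNorm w).trans ?_)
    exact mul_le_mul_of_nonneg_left ((pi_norm_le_iff_of_nonneg hM).2 hb) (norm_nonneg _)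
  refine ⟨fun γ => if h : γ ∈ G then -Ψ w ⟨γ, h⟩ + C₁ * M * a γ else 0, fun γ hγ => ?_, ?_⟩
  · simp only [hγ, dif_pos]
    have h1 := abs_le.1 (hΨw ⟨γ, hγ⟩)
    have h2 : 0 ≤ C₁ * M := by positivity
    have h3 := mul_le_mul_of_nonneg_left (ha γ hγ) h2
    have h4 := mul_le_mul_of_nonneg_left (Finset.single_le_sum (f := a)
      (fun γ hγ => zero_le_one.trans (ha γ hγ)) hγ) h2
    constructor <;> nlinarith
  · rw [← Finset.sum_coe_sort]
    simp only [Finset.coe_mem, dif_pos, Subtype.coe_eta, add_smul, neg_smul,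
      Finset.sum_add_distrib, Finset.sum_neg_distrib, mul_smul, ← Finset.smul_sum]
    rw [Finset.sum_coe_sort G fun γ => a γ • v γ, h0]
    have h5 : ∑ γ : G, Ψ w γ • v γ = Φ (Ψ w) := by simp [Φ, Fintype.linearCombination_apply]
    rw [h5, hw, hΦΨ]
    simp

theorem abs_floor_sum_sub_le {ι : Type*} (G : Finset ι) (v c : ι → ℝ) (V : ι → ℕ)
    (hV : ∀ γ ∈ G, |v γ| ≤ V γ) (hc : ∀ γ ∈ G, 0 ≤ c γ) :
    |∑ γ ∈ G, (⌊c γ⌋₊ : ℝ) * v γ - ∑ γ ∈ G, c γ * v γ| ≤ (∑ γ ∈ G, V γ : ℕ) := by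
  rw [← Finset.sum_sub_distrib]
  push_cast
  refine (Finset.abs_sum_le_sum_abs _ _).trans (Finset.sum_le_sum fun γ hγ => ?_)
  rw [← sub_mul, abs_mul]
  have h1 := Nat.floor_le (hc γ hγ)
  have h2 := Nat.lt_floor_add_one (c γ)
  have h3 : |(⌊c γ⌋₊ : ℝ) - c γ| ≤ 1 := abs_le.2 ⟨by linarith, by linarith⟩
  calc _ ≤ 1 * (V γ : ℝ) := mul_le_mul h3 (hV γ hγ) (abs_nonneg _) zero_le_one
    _ = _ := one_mul _

theorem safe_flatten_replicate {π : List (Q × (Fin d → ℤ) × Q)} {S : ℤ} {B : ℕ}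
    (hs : Safe (fun _ => S) π) (hB : ∀ i, -(B : ℤ) ≤ eff π i) (hS : 0 < S) (m : ℕ) :
    ∀ r : Fin d → ℤ, (∀ i, S + B * m ≤ r i) → Safe r (List.replicate m π).flatten := by
  induction m with
  | zero =>
    intro r hr i
    have := hr i
    push_cast at this
    linarith
  | succ m ih =>
    intro r hr
    rw [List.replicate_succ, List.flatten_cons, safe_append]
    push_cast at hr
    have hBm : (0 : ℤ) ≤ B * (m + 1) := by positivity
    refine ⟨hs.mono fun i => by linarith [hr i], ih _ fun i => ?_⟩
    have h1 := hr i
    have h2 := hB i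
    rw [Pi.add_apply]
    linarith

theorem abs_effR_le {A : VASS d Q} {π : List (Q × (Fin d → ℤ) × Q)} {p q : Q}
    (h : A.IsWalk p π q) (i : Fin d) : |effR π i| ≤ π.length := by
  have := h.abs_eff_le i
  rw [effR]
  exact_mod_cast this

theorem effR_eq_of_eff_eq {π σ : List (Q × (Fin d → ℤ) × Q)}
    {G : Finset (List (Q × (Fin d → ℤ) × Q))} {m : List (Q × (Fin d → ℤ) × Q) → ℕ}
    (h : eff π = eff σ + ∑ γ ∈ G, m γ • eff γ) (i : Fin d) :
    effR π i = effR σ i + ∑ γ ∈ G, (m γ : ℝ) * effR γ i := by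
  simp only [effR, h, Pi.add_apply, Finset.sum_apply, Pi.smul_apply]
  push_cast
  simp

variable [Finite Q]

/-- The short cycles orthogonal to `n`. -/
noncomputable def neutralCycles (A : VASS d Q) (n : Fin d → ℝ) :
    Finset (List (Q × (Fin d → ℤ) × Q)) :=
  (A.shortCycle_finite.subset
    (fun _ h => h.1 : {γ | A.IsShortCycle γ ∧ effR γ ⬝ᵥ n = 0} ⊆ _)).toFinset

theorem mem_neutralCycles {A : VASS d Q} {n : Fin d → ℝ} {γ : List (Q × (Fin d → ℤ) × Q)} :
    γ ∈ A.neutralCycles n ↔ A.IsShortCycle γ ∧ effR γ ⬝ᵥ n = 0 := by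
  simp [neutralCycles]

/-- Some combination with positive coefficients of the effects of the short cycles orthogonal
to `n` vanishes. -/
def Balanced (A : VASS d Q) (n : Fin d → ℝ) : Prop :=
  ∃ a : List (Q × (Fin d → ℤ) × Q) → ℝ, (∀ γ ∈ A.neutralCycles n, 1 ≤ a γ) ∧
    ∑ γ ∈ A.neutralCycles n, a γ • effR γ = 0

/-- The walk splits into short cycles, each closed in the neutral part and hence orthogonal to `n`;
`b` counts them. -/
theorem IsWalk.exists_effR_eq_sum {A : VASS d Q} {n : Fin d → ℝ}
    (hn : ∀ v ∈ A.Inc, v ⬝ᵥ n ≤ 0) {π : List (Q × (Fin d → ℤ) × Q)} {p : Q}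
    (h : (A.neutralPart n).IsWalk p π p) : ∃ b : List (Q × (Fin d → ℤ) × Q) → ℝ,
      (∀ γ, 0 ≤ b γ) ∧ effR π = ∑ γ ∈ A.neutralCycles n, b γ • effR γ := by
  classical
  obtain ⟨Γ, hΓ, hperm⟩ := h.exists_decomposition_of_closed
  rw [effR_perm hperm]
  clear hperm
  induction Γ with
  | nil => exact ⟨0, by simp, by simp⟩
  | cons γ Γ ih =>
    obtain ⟨b, hb, he⟩ := ih fun γ' hγ' => hΓ γ' (by simp [hγ'])
    obtain ⟨⟨p, h1, hw⟩, hl⟩ := hΓ γ (by simp)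
    have hγ : γ ∈ A.neutralCycles n := mem_neutralCycles.2
      ⟨⟨⟨p, h1, hw.mono (A.neutralPart_subset n)⟩, hl⟩, hw.dotProduct_eq_zero hn⟩
    refine ⟨b + Pi.single γ 1, fun γ' => add_nonneg (hb γ') ?_, ?_⟩
    · by_cases h : γ' = γ
      · subst h; simp
      · simp [h]
    · simp only [List.flatten_cons, effR_append, he, Pi.add_apply, add_smul,
        Finset.sum_add_distrib, Pi.single_apply, ite_smul, one_smul, zero_smul,
        Finset.sum_ite_eq', hγ, if_true]
      abel

/-- One round is `β'` (length at least `N ^ e`), a short return `ρ`, and a compensating tour `τ` of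
length `O(N)`. Its net effect is bounded independently of `N`, so `N` rounds are affordable. -/
theorem lowerPoly_succ (hd : 0 < d) {A : VASS d Q} (hA : ∀ p q, ∃ π, A.IsWalk p π q)
    {n : Fin d → ℝ} (hpos : ∀ i, 0 < n i) (hn : ∀ v ∈ A.Inc, v ⬝ᵥ n ≤ 0)
    (hbal : A.Balanced n) {R : Set Q} {e : ℕ}
    (h : ((A.neutralPart n).restrict R).LowerPoly e) :
    A.LowerPoly (e + 1) := by
  classical
  obtain ⟨a, ha, ha0⟩ := hbal
  set G := A.neutralCycles n
  have hGw : ∀ γ ∈ G, ∃ p, A.IsWalk p γ p := fun γ hγ => by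
    obtain ⟨⟨p, -, hw⟩, -⟩ := (mem_neutralCycles.1 hγ).1
    exact ⟨p, hw⟩
  obtain ⟨C, hC, hcomp⟩ := exists_compensation G effR a ha ha0
  choose σ hσ htour using exists_tour hA G hGw
  obtain ⟨L, hL⟩ := (Set.finite_range fun q => (σ q).length).bddAbove
  replace hL : ∀ q, (σ q).length ≤ L := fun q => hL ⟨q, rfl⟩
  obtain ⟨K₁, hK₁⟩ := exists_counter_bound hpos hn
  obtain ⟨K, hK⟩ := h
  set V := ∑ γ ∈ G, γ.length
  set c₀ := Nat.card Q
  set K₃ := K₁ * K + K + c₀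
  -- `K₃ * N` bounds the effect of `β' ++ ρ`, so each cycle is repeated at most `C * K₃ * N` times
  -- and `K₄ * N` bounds the tour length.
  obtain ⟨K₄, hK₄⟩ := exists_nat_ge (L + C * K₃ * V)
  set K₅ := K + c₀ + K₃ + K₄ + 1
  -- `K₅ * N` makes a single round safe; `L + V` bounds the loss per round: `L` from the fixed tour,
  -- `V` from rounding.
  refine ⟨K₅ + (L + V), fun N hN => ?_⟩
  obtain ⟨p, β, q, hβ, hβs, hβl⟩ := hK N hN
  have hβw := hβ.map_incl
  rw [← safe_map_incl] at hβs
  rw [← List.length_map (f := incl R)] at hβl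
  set β' := β.map (incl R)
  obtain ⟨ρ₀, hρ₀, -⟩ := hβw.exists_reverse
  -- The return walk may be long; only its short remainder, which has the same endpoints, is kept.
  obtain ⟨-, ρ, -, hρ, hρl, -⟩ := hρ₀.exists_decomposition
  have hclosed := hβw.append hρ
  have hβA := hβw.mono (A.neutralPart_subset n)
  have hρA := hρ.mono (A.neutralPart_subset n)
  obtain ⟨b, -, hb⟩ := hclosed.exists_effR_eq_sum hn
  have hNr : (1 : ℝ) ≤ N := by exact_mod_cast hN
  have hcN : (c₀ : ℤ) ≤ c₀ * N := le_mul_of_one_le_right (by positivity) (by exact_mod_cast hN)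
  have hbd : ∀ i, |eff (β' ++ ρ) i| ≤ (K₃ * N : ℕ) := by
    intro i
    have h1 := hβs.pos_end i
    have h2 := hK₁ (K * N) (one_le_of_safe hd hβs) _ _ _ hβA hβs i
    have h3 := abs_le.1 (hρA.abs_eff_le i)
    rw [eff_append, Pi.add_apply, abs_le]
    push_cast [K₃] at h1 h2 ⊢
    have h4 : (ρ.length : ℤ) ≤ c₀ := by exact_mod_cast hρl
    have h5 : (0 : ℤ) ≤ K₁ * (K * N) := by positivity
    have h6 : (0 : ℤ) ≤ K * N := by positivity
    constructor <;> linarith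
  obtain ⟨c, hc, hcsum⟩ := hcomp (K₃ * N : ℕ) b (by positivity) (by
    intro i
    rw [← hb, effR]
    exact_mod_cast hbd i)
  obtain ⟨τ, hτ, hτe, hτl⟩ := htour p fun γ => ⌊c γ⌋₊
  have hVb : ∀ i, |eff ((β' ++ ρ) ++ τ) i| ≤ (L + V : ℕ) := by
    intro i
    have h1 := effR_eq_of_eff_eq hτe i
    have h2 := abs_floor_sum_sub_le G (fun γ => effR γ i) c List.length
      (fun γ hγ => by obtain ⟨p, hp⟩ := hGw γ hγ; exact abs_effR_le hp i)
      fun γ hγ => (hc γ hγ).1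
    have h3 := congrFun hcsum i
    rw [← hb] at h3
    simp only [Finset.sum_apply, Pi.smul_apply, smul_eq_mul, Pi.neg_apply] at h3
    have h4 := (abs_effR_le (hσ p) i).trans (Nat.cast_le.2 (hL p))
    have h5 : effR ((β' ++ ρ) ++ τ) i = effR (σ p) i +
        (∑ γ ∈ G, (⌊c γ⌋₊ : ℝ) * effR γ i - ∑ γ ∈ G, c γ * effR γ i) := by
      rw [effR_append, Pi.add_apply, h1, h3]
      ring
    have h6 : |effR ((β' ++ ρ) ++ τ) i| ≤ (L + V : ℕ) := by
      rw [h5]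
      refine (abs_add_le _ _).trans ?_
      push_cast at h2 ⊢
      exact add_le_add h4 (by simpa [V] using h2)
    rw [effR] at h6
    exact_mod_cast h6
  have hτlen : τ.length ≤ K₄ * N := by
    have h1 : (∑ γ ∈ G, (⌊c γ⌋₊ : ℝ) * γ.length) ≤ C * K₃ * N * V := by
      simp only [V]
      push_cast
      rw [Finset.mul_sum]
      refine Finset.sum_le_sum fun γ hγ => mul_le_mul_of_nonneg_right ?_ (by positivity)
      refine (Nat.floor_le (hc γ hγ).1).trans ((hc γ hγ).2.trans (le_of_eq ?_))
      push_cast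
      ring
    have h2 : (τ.length : ℝ) ≤ K₄ * N := by
      rw [hτl]
      push_cast
      have h3 : ((σ p).length : ℝ) ≤ L * N :=
        (Nat.cast_le.2 (hL p)).trans (le_mul_of_one_le_right (by positivity) hNr)
      have h4 := mul_le_mul_of_nonneg_right hK₄ (zero_le_one.trans hNr)
      nlinarith
    exact_mod_cast h2
  have hNz : (1 : ℤ) ≤ N := by exact_mod_cast hN
  have hsafe : Safe (fun _ => ((K₅ * N : ℕ) : ℤ)) ((β' ++ ρ) ++ τ) := by
    have hKN : (0 : ℤ) ≤ K * N := by positivity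
    have hKN3 : (0 : ℤ) ≤ K₃ * N := by positivity
    have hKN4 : (0 : ℤ) ≤ K₄ * N := by positivity
    rw [safe_append, safe_append]
    refine ⟨⟨hβs.mono fun i => ?_, hρA.safe_of_length_lt fun i => ?_⟩,
      hτ.safe_of_length_lt fun i => ?_⟩
    · push_cast [K₅]
      linarith
    · have h1 := hβs.pos_end i
      have h2 : (ρ.length : ℤ) ≤ c₀ := by exact_mod_cast hρl
      rw [Pi.add_apply]
      push_cast [K₅] at h1 ⊢
      linarith
    · have h1 := abs_le.1 (hbd i)
      have h2 : (τ.length : ℤ) ≤ K₄ * N := by exact_mod_cast hτlen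
      rw [Pi.add_apply]
      push_cast [K₅] at h1 ⊢
      linarith
  refine ⟨p, _, p, ((hβA.append hρA).append hτ).flatten_replicate N,
    safe_flatten_replicate hsafe (fun i => (abs_le.1 (hVb i)).1) (hsafe.pos ⟨0, hd⟩) N _
      fun i => ?_, ?_⟩
  · push_cast
    linarith
  · rw [List.length_flatten, List.map_replicate, List.sum_replicate, smul_eq_mul, pow_succ,
      mul_comm]
    refine Nat.mul_le_mul_left _ ?_
    simp only [List.length_append]
    omega

/-- If all short cycles are orthogonal to `n` and `A` is balanced, there are arbitrarily long
computations from a fixed configuration. -/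
theorem exists_long_of_neutral {A : VASS d Q} (hT : A.trans.Nonempty)
    (hA : ∀ p q, ∃ π, A.IsWalk p π q) {n : Fin d → ℝ} (hn : ∀ v ∈ A.Inc, v ⬝ᵥ n ≤ 0)
    (hbal : A.Balanced n) (hneut : A.trans ⊆ (A.neutralPart n).trans) :
    ∃ M : ℕ, ∀ ℓ : ℕ, ∃ p π q, A.IsWalk p π q ∧ Safe (fun _ => (M : ℤ)) π ∧ ℓ ≤ π.length := by
  obtain ⟨a, ha, ha0⟩ := hbal
  set G := A.neutralCycles n
  obtain ⟨t, ht⟩ := hT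
  obtain ⟨-, γ₀, hγ₀, -, hγ₀n⟩ := hneut ht
  have hγ₀G : γ₀ ∈ G := mem_neutralCycles.2 ⟨hγ₀, hγ₀n⟩
  have hγ₀l : 1 ≤ γ₀.length := by
    obtain ⟨⟨p, h, -⟩, -⟩ := hγ₀
    exact h
  have hGw : ∀ γ ∈ G, ∃ p, A.IsWalk p γ p := fun γ hγ => by
    obtain ⟨⟨p, -, hw⟩, -⟩ := (mem_neutralCycles.1 hγ).1
    exact ⟨p, hw⟩
  obtain ⟨σ, hσ, htour⟩ := exists_tour hA G hGw t.1
  obtain ⟨b, hb0, hb⟩ := (hσ.mono hneut).exists_effR_eq_sum hn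
  -- These coefficients cancel `effR σ`. The multiple of `a` is large enough to make each of them at
  -- least `1`.
  set c := fun γ => (1 + ∑ γ ∈ G, b γ) * a γ - b γ
  have hc1 : ∀ γ ∈ G, 1 ≤ c γ := by
    intro γ hγ
    have h1 : b γ ≤ ∑ γ ∈ G, b γ := Finset.single_le_sum (fun γ _ => hb0 γ) hγ
    have h2 := mul_le_mul_of_nonneg_left (ha γ hγ)
      (add_nonneg zero_le_one (Finset.sum_nonneg fun γ (_ : γ ∈ G) => hb0 γ))
    simp only [c]
    linarith
  have hcsum : ∑ γ ∈ G, c γ • effR γ = -effR σ := by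
    simp only [c, sub_smul, Finset.sum_sub_distrib, mul_smul, ← Finset.smul_sum, ha0, hb]
    simp [G]
  set V := ∑ γ ∈ G, γ.length
  obtain ⟨K, hK⟩ := exists_nat_ge (σ.length + ∑ γ ∈ G, (c γ + 1) * γ.length)
  -- After `ℓ` rounds cycle `γ` has been run `⌊ℓ * c γ⌋₊` times in total, so rounding errors do not
  -- accumulate and the drift stays within `V`. A round has length at most `K`, so it is safe from
  -- counters at least `K + 1`.
  have key : ∀ ℓ : ℕ, ∃ π, A.IsWalk t.1 π t.1 ∧ Safe (fun _ => ((V + K + 1 : ℕ) : ℤ)) π ∧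
      ℓ ≤ π.length ∧
      ∀ i, effR π i = ℓ * effR σ i + ∑ γ ∈ G, (⌊ℓ * c γ⌋₊ : ℝ) * effR γ i := by
    intro ℓ
    induction ℓ with
    | zero => exact ⟨[], rfl, fun i => by positivity, by simp, by simp⟩
    | succ ℓ ih =>
      obtain ⟨π, hπ, hs, hl, he⟩ := ih
      obtain ⟨τ, hτ, hτe, hτl⟩ := htour fun γ => ⌊((ℓ + 1 : ℕ) : ℝ) * c γ⌋₊ - ⌊(ℓ : ℝ) * c γ⌋₊
      have hfl : ∀ γ ∈ G, ⌊(ℓ : ℝ) * c γ⌋₊ + 1 ≤ ⌊((ℓ + 1 : ℕ) : ℝ) * c γ⌋₊ := by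
        intro γ hγ
        have h1 := hc1 γ hγ
        rw [← Nat.floor_add_one (by positivity)]
        refine Nat.floor_le_floor ?_
        push_cast
        linarith
      refine ⟨π ++ τ, hπ.append hτ, safe_append.2 ⟨hs, hτ.safe_of_length_lt fun i => ?_⟩, ?_,
        fun i => ?_⟩
      · have h1 : |effR π i| ≤ V := by
          have h2 := abs_floor_sum_sub_le G (fun γ => effR γ i) (fun γ => ℓ * c γ) List.length
            (fun γ hγ => by obtain ⟨p, hp⟩ := hGw γ hγ; exact abs_effR_le hp i)
            fun γ hγ => mul_nonneg (by positivity) (zero_le_one.trans (hc1 γ hγ))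
          have h3 := congrFun hcsum i
          simp only [Finset.sum_apply, Pi.smul_apply, smul_eq_mul, Pi.neg_apply] at h3
          have h4 : ∑ γ ∈ G, ℓ * c γ * effR γ i = -(ℓ * effR σ i) := by
            simp only [mul_assoc, ← Finset.mul_sum, h3]
            ring
          rw [he i]
          rw [h4, sub_neg_eq_add, add_comm] at h2
          exact h2
        have h2 : τ.length ≤ K := by
          have h3 : (τ.length : ℝ) ≤ σ.length + ∑ γ ∈ G, (c γ + 1) * γ.length := by
            rw [hτl]
            push_cast
            refine add_le_add_right (Finset.sum_le_sum fun γ hγ =>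
              mul_le_mul_of_nonneg_right ?_ (by positivity)) _
            have h1 := hc1 γ hγ
            have h4 := hfl γ hγ
            push_cast at h4
            rw [Nat.cast_sub (by omega)]
            have h5 := Nat.floor_le (a := ((ℓ : ℝ) + 1) * c γ) (by positivity)
            have h6 := Nat.lt_floor_add_one ((ℓ : ℝ) * c γ)
            linarith
          exact_mod_cast h3.trans hK
        have h3 : |eff π i| ≤ V := by
          rw [effR] at h1
          exact_mod_cast h1
        have h4 := (abs_le.1 h3).1
        rw [Pi.add_apply]
        push_cast
        omega
      · have h1 : (⌊((ℓ + 1 : ℕ) : ℝ) * c γ₀⌋₊ - ⌊(ℓ : ℝ) * c γ₀⌋₊) * γ₀.length ≤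
            ∑ γ ∈ G, (⌊((ℓ + 1 : ℕ) : ℝ) * c γ⌋₊ - ⌊(ℓ : ℝ) * c γ⌋₊) * γ.length :=
          Finset.single_le_sum (f := fun γ => (⌊((ℓ + 1 : ℕ) : ℝ) * c γ⌋₊ -
            ⌊(ℓ : ℝ) * c γ⌋₊) * γ.length) (fun _ _ => Nat.zero_le _) hγ₀G
        have h2 := hfl γ₀ hγ₀G
        have h3 := Nat.mul_le_mul (show 1 ≤ ⌊((ℓ + 1 : ℕ) : ℝ) * c γ₀⌋₊ - ⌊(ℓ : ℝ) * c γ₀⌋₊ by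
          omega) hγ₀l
        rw [List.length_append, hτl]
        omega
      · rw [effR_append, Pi.add_apply, he i, effR_eq_of_eff_eq hτe i]
        have h1 : ∑ γ ∈ G, ((⌊((ℓ + 1 : ℕ) : ℝ) * c γ⌋₊ - ⌊(ℓ : ℝ) * c γ⌋₊ : ℕ) : ℝ) * effR γ i =
            ∑ γ ∈ G, (⌊((ℓ + 1 : ℕ) : ℝ) * c γ⌋₊ : ℝ) * effR γ i -
            ∑ γ ∈ G, (⌊(ℓ : ℝ) * c γ⌋₊ : ℝ) * effR γ i := by
          rw [← Finset.sum_sub_distrib]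
          refine Finset.sum_congr rfl fun γ hγ => ?_
          have := hfl γ hγ
          rw [Nat.cast_sub (by omega)]
          ring
        rw [h1]
        push_cast
        ring
  refine ⟨V + K + 1, fun ℓ => ?_⟩
  obtain ⟨π, hπ, hs, hl, -⟩ := key ℓ
  exact ⟨_, π, _, hπ, hs, hl⟩

end Lower

end VASS

namespace VASS

/-! ### Balanced normals -/

section GoodNormals

variable {d : ℕ}

/-- **Stiemke's lemma**. -/
theorem exists_pos_combination_eq_zero {ι : Type*} (G : Finset ι) (v : ι → Fin d → ℝ)
    (h : ∀ m : Fin d → ℝ, (∀ γ ∈ G, v γ ⬝ᵥ m ≤ 0) → ∀ γ ∈ G, v γ ⬝ᵥ m = 0) :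
    ∃ a : ι → ℝ, (∀ γ ∈ G, 1 ≤ a γ) ∧ ∑ γ ∈ G, a γ • v γ = 0 := by
  classical
  let L : (Fin d → ℝ) →ₗ[ℝ] (G → ℝ) :=
    { toFun := fun m γ => v γ ⬝ᵥ m
      map_add' := fun x y => by ext; simp [dotProduct_add]
      map_smul' := fun r x => by ext; simp [dotProduct_smul] }
  -- The hypothesis says that the range of `L` contains no nonzero vector of constant sign. A
  -- separating functional vanishes on this subspace and is negative at the simplex vertices, which
  -- gives the coefficients.
  have hdisj : Disjoint (stdSimplex ℝ G) (LinearMap.range L : Set (G → ℝ)) := by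
    rw [Set.disjoint_left]
    rintro _ ⟨hx0, hx1⟩ ⟨m, rfl⟩
    have h1 := h (-m) fun γ hγ => by
      have := hx0 ⟨γ, hγ⟩
      simpa [L] using this
    have h2 : ∀ γ : G, L m γ = 0 := fun γ => by simpa [L] using h1 γ γ.2
    simp [h2] at hx1
  obtain ⟨f, u, w, hf1, huw, hf2⟩ := geometric_hahn_banach_compact_closed
    (convex_stdSimplex ℝ G) (isCompact_stdSimplex ℝ G) (LinearMap.range L).convex
    (LinearMap.range L).closed_of_finiteDimensional hdisj
  have hw : w < 0 := by simpa using hf2 0 (LinearMap.range L).zero_mem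
  have hfL : ∀ m, f (L m) = 0 := by
    intro m
    by_contra hne
    have := hf2 (L ((w / f (L m)) • m)) ⟨_, rfl⟩
    rw [map_smul, map_smul, smul_eq_mul, div_mul_cancel₀ _ hne] at this
    exact lt_irrefl _ this
  have ha : ∀ γ : G, 0 < -f (Pi.single γ 1) := by
    intro γ
    have := hf1 _ (single_mem_stdSimplex ℝ γ)
    linarith
  have hsum : ∑ γ : G, (-f (Pi.single γ 1)) • v γ = 0 := by
    refine dotProduct_eq_zero_iff.1 fun m => ?_
    rw [sum_dotProduct]
    have h1 : L m = ∑ γ : G, (v γ ⬝ᵥ m) • (Pi.single γ 1 : G → ℝ) := by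
      ext γ
      simp [L, Finset.sum_apply, Pi.single_apply]
    have h2 := hfL m
    rw [h1, map_sum] at h2
    simp only [map_smul, smul_eq_mul] at h2
    simp only [smul_dotProduct, smul_eq_mul, neg_mul, Finset.sum_neg_distrib, neg_eq_zero]
    rw [← h2]
    exact Finset.sum_congr rfl fun γ _ => mul_comm _ _
  -- Scaling by the sum of the inverses raises every coefficient to at least `1`.
  set s := ∑ γ : G, (-f (Pi.single γ 1))⁻¹
  refine ⟨fun γ => if hγ : γ ∈ G then s * -f (Pi.single ⟨γ, hγ⟩ 1) else 0, fun γ hγ => ?_, ?_⟩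
  · simp only [hγ, dif_pos]
    have h1 : (-f (Pi.single ⟨γ, hγ⟩ 1))⁻¹ ≤ s :=
      Finset.single_le_sum (f := fun γ : G => (-f (Pi.single γ 1))⁻¹)
        (fun γ _ => (inv_pos.2 (ha γ)).le) (Finset.mem_univ _)
    calc (1 : ℝ) = (-f (Pi.single ⟨γ, hγ⟩ 1))⁻¹ * -f (Pi.single ⟨γ, hγ⟩ 1) :=
          (inv_mul_cancel₀ (ha _).ne').symm
      _ ≤ _ := mul_le_mul_of_nonneg_right h1 (ha _).le
  · rw [← Finset.sum_coe_sort]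
    simp only [Finset.coe_mem, dif_pos, Subtype.coe_eta, mul_smul, ← Finset.smul_sum]
    rw [hsum, smul_zero]

variable {Q : Type*} [Finite Q]

/-- Take a positive normal with fewest neutral cycles. Were it not balanced, Stiemke's lemma would
give a direction `m` nonpositive on all neutral cycles and negative on one; `n + ε • m` for small `ε
> 0` would have fewer. -/
theorem exists_balanced_normal {A : VASS d Q} (hC : A.ConditionC) :
    ∃ n : Fin d → ℝ, (∀ i, 0 < n i) ∧ (∀ v ∈ A.Inc, v ⬝ᵥ n ≤ 0) ∧ A.Balanced n := by
  classical
  obtain ⟨n₀, ⟨-, hn₀⟩, hpos₀⟩ := hC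
  obtain ⟨n, ⟨hpos, hn⟩, hmin⟩ := (measure fun n => (A.neutralCycles n).card).wf.has_min
    {n : Fin d → ℝ | (∀ i, 0 < n i) ∧ ∀ v ∈ A.Inc, v ⬝ᵥ n ≤ 0} ⟨n₀, hpos₀, hn₀⟩
  refine ⟨n, hpos, hn, exists_pos_combination_eq_zero _ effR fun m hm γ₀ hγ₀ => ?_⟩
  by_contra hne
  have hlt : effR γ₀ ⬝ᵥ m < 0 := lt_of_le_of_ne (hm γ₀ hγ₀) hne
  have h1 : ∀ᶠ ε in nhdsWithin (0 : ℝ) (Set.Ioi 0), ∀ i, 0 < n i + ε * m i := by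
    rw [eventually_all]
    intro i
    refine nhdsWithin_le_nhds (ContinuousAt.eventually_lt (by fun_prop) (by fun_prop) ?_)
    simpa using hpos i
  have h2 : ∀ᶠ ε in nhdsWithin (0 : ℝ) (Set.Ioi 0), ∀ γ ∈ {γ | A.IsShortCycle γ},
      effR γ ⬝ᵥ n < 0 → effR γ ⬝ᵥ n + ε * (effR γ ⬝ᵥ m) < 0 := by
    rw [Set.Finite.eventually_all A.shortCycle_finite]
    intro γ _
    by_cases h : effR γ ⬝ᵥ n < 0
    · have : ∀ᶠ ε in nhdsWithin (0 : ℝ) (Set.Ioi 0), effR γ ⬝ᵥ n + ε * (effR γ ⬝ᵥ m) < 0 := by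
        refine nhdsWithin_le_nhds (ContinuousAt.eventually_lt (by fun_prop) (by fun_prop) ?_)
        simpa using h
      exact this.mono fun _ h _ => h
    · exact Eventually.of_forall fun _ h' => absurd h' h
  obtain ⟨ε, h1, h2, hε⟩ := (h1.and (h2.and self_mem_nhdsWithin)).exists
  replace hε : 0 < ε := hε
  have hdot : ∀ v : Fin d → ℝ, v ⬝ᵥ (n + ε • m) = v ⬝ᵥ n + ε * (v ⬝ᵥ m) := fun v => by
    rw [dotProduct_add, dotProduct_smul, smul_eq_mul]
  refine hmin (n + ε • m) ⟨h1, ?_⟩ (Finset.card_lt_card ?_)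
  · rintro _ ⟨γ, hγ, rfl⟩
    rw [hdot]
    rcases (hn _ ⟨γ, hγ, rfl⟩).eq_or_lt with h | h
    · have := mul_nonpos_of_nonneg_of_nonpos hε.le (hm γ (mem_neutralCycles.2 ⟨hγ, h⟩))
      linarith
    · exact (h2 γ hγ h).le
  · rw [Finset.ssubset_iff_of_subset]
    · refine ⟨γ₀, hγ₀, fun h => ?_⟩
      have h3 := (mem_neutralCycles.1 h).2
      rw [hdot, (mem_neutralCycles.1 hγ₀).2] at h3
      have := mul_neg_of_pos_of_neg hε hlt
      linarith
    · intro γ hγ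
      obtain ⟨hγs, h3⟩ := mem_neutralCycles.1 hγ
      refine mem_neutralCycles.2 ⟨hγs, ?_⟩
      rw [hdot] at h3
      by_contra h4
      exact (h2 γ hγs (lt_of_le_of_ne (hn _ ⟨γ, hγs, rfl⟩) h4)).ne h3

/-- A cone element orthogonal to `n` is a combination of neutral cycles only. By goodness this
applies to `-effR γ` for each neutral `γ`; adding `effR γ` and summing over `γ` gives zero with
coefficients at least `1`. -/
theorem IsGoodNormal.balanced {A : VASS d Q} {n : Fin d → ℝ} (h : A.IsGoodNormal n) :
    A.Balanced n := by
  classical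
  obtain ⟨⟨-, hn⟩, -, hgood⟩ := h
  set G := A.neutralCycles n
  have hhull : ∀ v ∈ PointedCone.hull ℝ A.Inc, v ⬝ᵥ n ≤ 0 ∧ (v ⬝ᵥ n = 0 →
      ∃ c : List (Q × (Fin d → ℤ) × Q) → ℝ, (∀ γ, 0 ≤ c γ) ∧ v = ∑ γ ∈ G, c γ • effR γ) := by
    intro v hv
    induction hv using Submodule.span_induction with
    | mem v hv =>
      refine ⟨hn v hv, fun h0 => ?_⟩
      obtain ⟨γ, hγ, rfl⟩ := hv
      have hγG : γ ∈ G := mem_neutralCycles.2 ⟨hγ, h0⟩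
      refine ⟨fun γ' => if γ' = γ then 1 else 0, fun γ' => ?_, ?_⟩
      · positivity
      · simp [hγG]
    | zero => exact ⟨by simp, fun _ => ⟨0, by simp, by simp⟩⟩
    | add x y _ _ hx hy =>
      rw [add_dotProduct]
      refine ⟨add_nonpos hx.1 hy.1, fun h0 => ?_⟩
      obtain ⟨c, hc, hcx⟩ := hx.2 (by linarith [hx.1, hy.1])
      obtain ⟨c', hc', hcy⟩ := hy.2 (by linarith [hx.1, hy.1])
      refine ⟨c + c', fun γ => add_nonneg (hc γ) (hc' γ), ?_⟩
      simp only [Pi.add_apply, add_smul, Finset.sum_add_distrib]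
      rw [← hcx, ← hcy]
    | smul r x _ hx =>
      have hr : r • x = (r : ℝ) • x := rfl
      rw [hr, smul_dotProduct, smul_eq_mul]
      refine ⟨mul_nonpos_of_nonneg_of_nonpos r.2 hx.1, fun h0 => ?_⟩
      rcases mul_eq_zero.1 h0 with h0 | h0
      · exact ⟨0, by simp, by simp [h0]⟩
      · obtain ⟨c, hc, hcx⟩ := hx.2 h0
        refine ⟨fun γ => r * c γ, fun γ => mul_nonneg r.2 (hc γ), ?_⟩
        simp only [mul_smul, ← Finset.smul_sum]
        rw [← hcx]
  have hneg : ∀ γ ∈ G, ∃ c : List (Q × (Fin d → ℤ) × Q) → ℝ, (∀ γ', 0 ≤ c γ') ∧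
      -effR γ = ∑ γ' ∈ G, c γ' • effR γ' := by
    intro γ hγ
    obtain ⟨hγs, h0⟩ := mem_neutralCycles.1 hγ
    have hmem : effR γ ∈ PointedCone.hull ℝ A.Inc := Submodule.subset_span ⟨γ, hγs, rfl⟩
    exact (hhull _ ((hgood _ hmem).2 h0)).2 (by rw [neg_dotProduct, h0, neg_zero])
  choose! c hc0 hc using hneg
  refine ⟨fun γ => 1 + ∑ γ' ∈ G, c γ' γ, fun γ _ => ?_, ?_⟩
  · have := Finset.sum_nonneg fun γ' hγ' => hc0 γ' hγ' γ
    linarith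
  · simp only [add_smul, one_smul, Finset.sum_add_distrib, Finset.sum_smul]
    rw [Finset.sum_comm, ← Finset.sum_congr rfl hc, Finset.sum_neg_distrib, add_neg_cancel]

end GoodNormals

end VASS

namespace VASS

/-! ### Polynomial growth and the final assembly -/

section Dichotomy

variable {d : ℕ}

theorem UpperPoly.terminatingTheta {Q : Type*} (hd : 0 < d) {A : VASS d Q} {k : ℕ}
    (hu : A.UpperPoly k) (hl : A.LowerPoly k) : A.TerminatingTheta (fun m => m ^ k) := by
  obtain ⟨K, hK⟩ := hu
  obtain ⟨K', hK'⟩ := hl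
  have hle : ∀ m, A.complexity m ≤ ((K * m ^ k : ℕ) : ℕ∞) := fun m =>
    (complexity_le_iff hd A m _).2 fun p π q hw hs => by exact_mod_cast hK m p π q hw hs
  have hterm : A.Terminating := fun m => ne_top_of_le_ne_top (ENat.natCast_ne_top _) (hle m)
  refine ⟨hterm, ?_, ?_⟩
  · refine IsBigO.of_bound K (Eventually.of_forall fun m => ?_)
    rw [Real.norm_natCast, Real.norm_natCast]
    exact_mod_cast ENat.toNat_le_of_le_natCast (hle m)
  · have hK'0 : 1 ≤ K' := by
      obtain ⟨p, π, q, -, hs, -⟩ := hK' 1 le_rfl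
      have := one_le_of_safe hd hs
      omega
    refine IsBigO.of_bound ((2 * K') ^ k) ((eventually_ge_atTop K').mono fun m hm => ?_)
    rw [Real.norm_natCast, Real.norm_natCast]
    have hN : 1 ≤ m / K' := (Nat.one_le_div_iff hK'0).2 hm
    obtain ⟨p, π, q, hw, hs, hlen⟩ := hK' (m / K') hN
    have h1 : K' * (m / K') ≤ m := Nat.mul_div_le m K'
    have h2 := le_complexity hd A m hw (hs.mono fun _ => by exact_mod_cast h1)
    have h3 : (m / K') ^ k ≤ (A.complexity m).toNat :=
      hlen.trans ((ENat.natCast_le_natCast).1 (h2.trans_eq (ENat.natCast_toNat (hterm m)).symm))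
    -- `LowerPoly` speaks only of sizes `K' * N`; taking `N = m / K'` loses at most a factor `2`
    -- once `m ≥ K'`.
    have h4 : m ≤ 2 * K' * (m / K') := by
      have h5 := Nat.lt_mul_div_succ m hK'0
      nlinarith
    have h6 : m ^ k ≤ (2 * K') ^ k * (A.complexity m).toNat := by
      calc m ^ k ≤ (2 * K' * (m / K')) ^ k := Nat.pow_le_pow_left h4 k
        _ = (2 * K') ^ k * (m / K') ^ k := mul_pow _ _ _
        _ ≤ _ := Nat.mul_le_mul_left _ h3
    exact_mod_cast h6

theorem Terminating.restrict_neutralPart {Q : Type*} (hd : 0 < d) {A : VASS d Q}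
    (h : A.Terminating) (n : Fin d → ℝ) (R : Set Q) :
    ((A.neutralPart n).restrict R).Terminating := by
  intro m
  refine ne_top_of_le_ne_top (h m) ((complexity_le_iff hd _ m _).2 fun p π q hw hs => ?_)
  have := le_complexity hd A m (hw.map_incl.mono (A.neutralPart_subset n))
    ((safe_map_incl R π _).2 hs)
  rwa [List.length_map] at this

theorem conditionC_restrict {Q : Type*} [Finite Q] (hd : 0 < d) {A : VASS d Q} {n : Fin d → ℝ}
    (hpos : ∀ i, 0 < n i) (hn : ∀ v ∈ A.Inc, v ⬝ᵥ n ≤ 0) (R : Set Q) :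
    ((A.neutralPart n).restrict R).ConditionC := by
  refine ⟨n, ⟨fun h => ?_, ?_⟩, hpos⟩
  · have := hpos ⟨0, hd⟩
    simp [h] at this
  · rintro _ ⟨γ, ⟨⟨p, -, hw⟩, -⟩, rfl⟩
    have h1 : effR γ = effR (γ.map (incl R)) := by
      ext i
      simp only [effR, eff_map_incl]
    rw [h1]
    exact (hw.map_incl.mono (A.neutralPart_subset n)).dotProduct_nonpos hn

/-- The termination complexity of a strongly connected terminating VASS with a positive normal is
polynomial. -/
theorem exists_upperPoly_lowerPoly {d : ℕ} (hd : 0 < d) {Q : Type*} [Finite Q] (A : VASS d Q)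
    (hT : A.trans.Nonempty) (hA : ∀ p q, ∃ π, A.IsWalk p π q) (hC : A.ConditionC)
    (hterm : A.Terminating) : ∃ k, A.UpperPoly k ∧ A.LowerPoly k := by
  induction hN : A.trans.ncard using Nat.strong_induction_on generalizing Q with
  | _ N ih =>
  obtain ⟨n, hpos, hn, hbal⟩ := exists_balanced_normal hC
  have hlt : ∀ R, ((A.neutralPart n).restrict R).trans.ncard < N := by
    intro R
    -- If every transition were neutral, one fixed configuration size would allow arbitrarily long
    -- computations, against termination.
    have hss : (A.neutralPart n).trans ⊂ A.trans := by
      refine (A.neutralPart_subset n).ssubset_of_not_subset fun hsub => ?_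
      obtain ⟨M, hM⟩ := exists_long_of_neutral hT hA hn hbal hsub
      refine hterm M (ENat.eq_top_iff_forall_ge.2 fun ℓ => ?_)
      obtain ⟨p, π, q, hw, hs, hl⟩ := hM ℓ
      exact (Nat.cast_le.2 hl).trans (le_complexity hd A M hw hs)
    rw [← hN]
    refine lt_of_le_of_lt ?_ (Set.ncard_lt_ncard hss A.trans_finite)
    exact Set.ncard_le_ncard_of_injOn (incl R) (fun t ht => ht) (incl_injective R).injOn
      (A.neutralPart n).trans_finite
  have hpoly : ∀ R ∈ (A.neutralPart n).nontrivialSCCs, ∃ k,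
      ((A.neutralPart n).restrict R).UpperPoly k ∧ ((A.neutralPart n).restrict R).LowerPoly k :=
    fun R hR => ih _ (hlt R) _ hR.2 hR.1.exists_walk_restrict (conditionC_restrict hd hpos hn R)
      (hterm.restrict_neutralPart hd n R) rfl
  choose! k hku hkl using hpoly
  rcases (A.neutralPart n).nontrivialSCCs.eq_empty_or_nonempty with h0 | h0
  · exact ⟨1, upperPoly_succ hd hpos hn (e := 0) (by simp [h0]), lowerPoly_one hT hA⟩
  · obtain ⟨R, hR, hmax⟩ := Set.exists_max_image _ k (Set.toFinite _) h0
    exact ⟨k R + 1, upperPoly_succ hd hpos hn fun S hS => (hku S hS).mono hd (hmax S hS),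
      lowerPoly_succ hd hA hpos hn hbal (hkl R hR)⟩

theorem isTheta_finset_sup {k : ℕ} (f : Fin k → ℕ → ℕ) (e : Fin k → ℕ) (i₀ : Fin k)
    (hmax : ∀ i, e i ≤ e i₀)
    (h : ∀ i, (fun m : ℕ => (f i m : ℝ)) =Θ[atTop] fun m : ℕ => ((m ^ e i : ℕ) : ℝ)) :
    (fun m : ℕ => ((Finset.univ.sup fun i => f i m : ℕ) : ℝ)) =Θ[atTop]
      fun m : ℕ => ((m ^ e i₀ : ℕ) : ℝ) := by
  constructor
  · have h1 : (fun m : ℕ => ∑ i, (f i m : ℝ)) =O[atTop] fun m : ℕ => ((m ^ e i₀ : ℕ) : ℝ) := by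
      refine IsBigO.fun_sum fun i _ => (h i).1.trans ?_
      refine IsBigO.of_bound 1 ((eventually_ge_atTop 1).mono fun m hm => ?_)
      rw [Real.norm_natCast, Real.norm_natCast, one_mul]
      exact_mod_cast Nat.pow_le_pow_right hm (hmax i)
    refine (IsBigO.of_bound 1 (Eventually.of_forall fun m => ?_)).trans h1
    rw [Real.norm_natCast, one_mul, ← Nat.cast_sum, Real.norm_natCast]
    exact_mod_cast Finset.sup_le fun i hi =>
      Finset.single_le_sum (f := fun i => f i m) (fun _ _ => Nat.zero_le _) hi
  · refine (h i₀).2.trans (IsBigO.of_bound 1 (Eventually.of_forall fun m => ?_))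
    rw [Real.norm_natCast, Real.norm_natCast, one_mul]
    exact_mod_cast Finset.le_sup (f := fun i => f i m) (Finset.mem_univ i₀)

end Dichotomy

end VASS

theorem mainTheorem4 {d : ℕ} (hd : 0 < d) {Q : Type*} [Finite Q] [Nonempty Q]
    (A : VASS d Q) (hT : A.trans.Nonempty) (hsc : A.StronglyConnected) (hC : A.ConditionC)
    (n : Fin d → ℝ) (hn : A.IsGoodNormal n)
    (k : ℕ) (C : Fin k → Set Q) (hinj : Function.Injective C)
    (hC_all : Set.range C = (A.neutralPart n).nontrivialSCCs) :
    (k = 0 → A.TerminatingTheta (fun m => m)) ∧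
    (0 < k → ∀ f : Fin k → ℕ → ℕ,
      (∀ i, ((A.neutralPart n).restrict (C i)).TerminatingTheta (f i)) →
        A.TerminatingTheta (fun m => m * Finset.univ.sup (fun i => f i m))) := by
  have hA := hsc.exists_walk
  obtain ⟨⟨-, hInc⟩, hpos, -⟩ := id hn
  constructor
  · rintro rfl
    have h0 : (A.neutralPart n).nontrivialSCCs = ∅ := by rw [← hC_all, Set.range_eq_empty]
    have hu : A.UpperPoly 1 := VASS.upperPoly_succ hd hpos hInc (e := 0) (by simp [h0])
    simpa using hu.terminatingTheta hd (VASS.lowerPoly_one hT hA)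
  · intro hk f hf
    have hmem : ∀ i, C i ∈ (A.neutralPart n).nontrivialSCCs := fun i =>
      hC_all ▸ Set.mem_range_self i
    choose e heu hel using fun i => VASS.exists_upperPoly_lowerPoly hd
      ((A.neutralPart n).restrict (C i)) (hmem i).2 (hmem i).1.exists_walk_restrict
      (VASS.conditionC_restrict hd hpos hInc (C i)) (hf i).1
    have : Nonempty (Fin k) := ⟨⟨0, hk⟩⟩
    obtain ⟨i₀, hi₀⟩ := Finite.exists_max e
    have hu : A.UpperPoly (e i₀ + 1) := VASS.upperPoly_succ hd hpos hInc fun R hR => by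
      obtain ⟨i, rfl⟩ := hC_all.symm.subset hR
      exact (heu i).mono hd (hi₀ i)
    obtain ⟨hterm, hΘ⟩ := hu.terminatingTheta hd
      (VASS.lowerPoly_succ hd hA hpos hInc hn.balanced (hel i₀))
    refine ⟨hterm, hΘ.trans ?_⟩
    -- Each `f i` is `Θ(m ^ e i)` because both describe the same complexity, so the maximum has the
    -- largest exponent `e i₀`.
    have h1 := VASS.isTheta_finset_sup f e i₀ hi₀ fun i =>
      (hf i).2.symm.trans ((heu i).terminatingTheta hd (hel i)).2
    have h2 := (isTheta_refl (fun m : ℕ => (m : ℝ)) atTop).mul h1.symm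
    simpa only [pow_succ', Nat.cast_mul] using h2
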